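/- A normed wqo (nwqo) is a well-quasi-order $(A,\le_A)$ with a norm $|\cdot|_A:A\to\mathbb{N}$ such that $\{x\in A:|x|_A<n\}$ is finite for every $n$. For $g:\mathbb{N}\to\mathbb{N}$ and $n\in\mathbb{N}$, a finite sequence $x_0,x_1,\dots,x_{l-1}$ over $A$ is $(g,n)$-controlled if $|x_i|_A\le g^i(n)$ for all $i$ (with $g^i$ the $i$-th iterate of $g$), and bad if there are no $i<j$ with $x_i\le_A x_j$; $L_{A,g}(n)$ denotes the maximum length of a $(g,n)$-controlled bad sequence over $A$. $\Gamma_k$ is the nwqo of $k$ pairwise incomparable elements of norm $0$. $\mathbb{N}^d$ carries the product order and the maximum norm, and $\mathbb{P}_f(\mathbb{N}^d)$, the set of its finite subsets, carries the majoring order $X\sqsubseteq^{\mathtt{maj}}Y\iff\forall x\in X\,\exists y\in Y:\ x\le y$ and the norm $|X|=\max(\{|x|:x\in X\}\cup\{\mathrm{card}(X)\})$. Disjoint sums $A+B$ keep the norms and leave elements of different summands incomparable; products $A\times B$ carry the product order and the norm $\max(|x|_A,|y|_B)$. The majoring powerset nwqos are those obtained from $\Gamma_0,\Gamma_1$ and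 $\mathbb{P}_f(\mathbb{N}^d)$ $(d>0)$ by disjoint sums and cartesian products; their order types are $$o(\Gamma_0)=0,\quad o(\Gamma_1)=1,\quad o(\mathbb{P}_f(\mathbb{N}^d))=\omega^{\omega^{d-1}},\quad o(A+B)=o(A)\oplus o(B),\quad o(A\times B)=o(A)\otimes o(B),$$ with $\oplus,\otimes$ the natural sum and product of ordinals (always $o(A)<\omega^{\omega^{\omega}}$). For $\alpha=\omega^{\beta_1}\cdot c_1+\dots+\omega^{\beta_m}\cdot c_m<\varepsilon_0$ with $\beta_1>\dots>\beta_m$ and integers $c_i>0$, let $N\alpha=\max\{c_1,\dots,c_m,N\beta_1,\dots,N\beta_m\}$ (and $N0=0$); $\alpha$ is $k$-lean if $N\alpha\le k$. For $n\in\mathbb{N}$ put $D_n(1)=0$, $D_n(\omega)=n+1$, $D_n(\omega^{\omega^d})=\omega^{\omega^{d-1}\cdot(d+1)n}$ for integers $d\ge1$, and $D_n(\omega^{\omega^{p_1}+\dots+\omega^{p_r}})=\bigoplus_{i=1}^r\bigl(D_n(\omega^{\omega^{p_i}})\otimes\bigotimes_{j\ne i}\omega^{\omega^{p_j}}\bigr)$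 for integers $p_1\ge\dots\ge p_r\ge 0$. For $\alpha=\omega^{\beta_1}+\dots+\omega^{\beta_m}<\omega^{\omega^{\omega}}$ with $\beta_1\ge\dots\ge\beta_m$ put $\partial_n(\alpha)=\{D_n(\omega^{\beta_i})\oplus\bigoplus_{j\ne i}\omega^{\beta_j}:1\le i\le m\}$; every element of $\partial_n(\alpha)$ is smaller than $\alpha$, and one defines recursively $$M_{\alpha,g}(n)=\max_{\alpha'\in\partial_n(\alpha)}\{1+M_{\alpha',g}(g(n))\}\qquad(\max\emptyset=0).$$ For limit ordinals below $\varepsilon_0$ fix the fundamental sequences $(\gamma+\omega^{\beta+1})(x)=\gamma+\omega^{\beta}\cdot(x+1)$ and $(\gamma+\omega^{\lambda})(x)=\gamma+\omega^{\lambda(x)}$, where $\lambda$ is a limit ordinal and the last displayed power of $\omega$ is the last term of the Cantor normal form. Put $P_x(\alpha+1)=\alpha$ and $P_x(\lambda)=P_x(\lambda(x))$. The Cichoń hierarchy of $h:\mathbb{N}\to\mathbb{N}$ is $h_0(x)=0$ and $h_\alpha(x)=1+h_{P_x(\alpha)}(h(x))$ for $0<\alpha<\varepsilon_0$. **Theorem.**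 Let $g:\mathbb{N}\to\mathbb{N}$ be strictly increasing (hence $g(n)\ge n$ for all $n$) and let $h(x)=4x\cdot g(x)$. Let $A$ be any majoring powerset nwqo whose order type $o(A)$ is $k$-lean, and let $n>0$. Then the maximum $L_{A,g}(n)$ exists and $$L_{A,g}(n)\le M_{o(A),g}(n)\le h_{o(A)}(4kn).$$ In particular, for all $d>0$ and $n>0$, $$L_{(\mathbb{P}_f(\mathbb{N}^d),\sqsubseteq^{\mathtt{maj}}),g}(n)\le h_{\omega^{\omega^{d-1}}}(4dn).$$ -/

import Mathlib

open Ordinal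

namespace MajoringPowerset

/-! ## Normed well-quasi-orders -/

/-- A normed wqo: a quasi-order which is a well-quasi-order, with a norm into `ℕ` whose
sublevel sets are finite. -/
structure NormedWqo where
  carrier : Type
  le : carrier → carrier → Prop
  norm : carrier → ℕ
  le_refl : ∀ x, le x x
  le_trans : ∀ x y z, le x y → le y z → le x z
  wqo : WellQuasiOrdered le
  finite_norm_lt : ∀ n : ℕ, {x : carrier | norm x < n}.Finite

namespace NormedWqo

/-- `x 0, …, x (l - 1)` is a `(g, n)`-controlled sequence: `|x i| ≤ g^i(n)` for every `i`. -/
def IsControlled (A : NormedWqo) (g : ℕ → ℕ) (n : ℕ) {l : ℕ} (x : Fin l → A.carrier) : Prop :=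
  ∀ i : Fin l, A.norm (x i) ≤ g^[(i : ℕ)] n

/-- A finite sequence is bad if it has no pair `i < j` with `x i ≤ x j`. -/
def IsBad (A : NormedWqo) {l : ℕ} (x : Fin l → A.carrier) : Prop :=
  ∀ i j : Fin l, i < j → ¬ A.le (x i) (x j)

/-- The lengths of the `(g, n)`-controlled bad sequences over `A`. -/
def controlledBadLengths (A : NormedWqo) (g : ℕ → ℕ) (n : ℕ) : Set ℕ :=
  {l | ∃ x : Fin l → A.carrier, A.IsControlled g n x ∧ A.IsBad x}

/-- The length function `L_{A,g}(n)`: the maximum length of a `(g, n)`-controlled bad sequence. -/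
noncomputable def lengthFn (A : NormedWqo) (g : ℕ → ℕ) (n : ℕ) : ℕ :=
  sSup (A.controlledBadLengths g n)

/-- `Γ_k`: `k` pairwise incomparable elements of norm `0`. -/
def gamma (k : ℕ) : NormedWqo where
  carrier := Fin k
  le x y := x = y
  norm _ := 0
  le_refl _ := rfl
  le_trans _ _ _ := Eq.trans
  wqo := Finite.wellQuasiOrdered _
  finite_norm_lt _ := Set.toFinite _

/-- `ℕ^d` with the product ordering and the maximum norm. -/
def natPow (d : ℕ) : NormedWqo where
  carrier := Fin d → ℕ
  le x y := ∀ i, x i ≤ y i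
  norm x := Finset.univ.sup x
  le_refl _ _ := le_rfl
  le_trans _ _ _ h₁ h₂ i := (h₁ i).trans (h₂ i)
  wqo := WellQuasiOrdered.pi (r := fun _ : Fin d => ((· ≤ ·) : ℕ → ℕ → Prop))
    fun _ => wellQuasiOrdered_le
  finite_norm_lt n := by
    refine (Set.finite_Iic (fun _ : Fin d => n)).subset fun x hx i => ?_
    exact (Finset.le_sup (f := x) (Finset.mem_univ i)).trans (le_of_lt hx)

/-- The disjoint sum `A + B`. -/
def sum (A B : NormedWqo) : NormedWqo where
  carrier := A.carrier ⊕ B.carrier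
  le := Sum.LiftRel A.le B.le
  norm := Sum.elim A.norm B.norm
  le_refl
    | .inl x => .inl (A.le_refl x)
    | .inr x => .inr (B.le_refl x)
  le_trans
    | _, _, _, .inl h₁, .inl h₂ => .inl (A.le_trans _ _ _ h₁ h₂)
    | _, _, _, .inr h₁, .inr h₂ => .inr (B.le_trans _ _ _ h₁ h₂)
  wqo := by
    intro f
    by_cases hinf : {i | ∃ a, f i = Sum.inl a}.Infinite
    · have key := fun i => Nat.nth_mem_of_infinite hinf i
      choose a ha using key
      obtain ⟨m, n, hmn, h⟩ := A.wqo a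
      refine ⟨_, _, Nat.nth_strictMono hinf hmn, ?_⟩
      rw [ha m, ha n]
      exact .inl h
    · have hinf' : {i | ∃ b, f i = Sum.inr b}.Infinite := by
        rw [Set.not_infinite] at hinf
        refine hinf.infinite_compl.mono fun i hi => ?_
        rcases hfi : f i with a | b
        · exact absurd ⟨a, hfi⟩ hi
        · exact ⟨b, hfi⟩
      have key := fun i => Nat.nth_mem_of_infinite hinf' i
      choose b hb using key
      obtain ⟨m, n, hmn, h⟩ := B.wqo b
      refine ⟨_, _, Nat.nth_strictMono hinf' hmn, ?_⟩
      rw [hb m, hb n]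
      exact .inr h
  finite_norm_lt n := by
    refine (((A.finite_norm_lt n).image Sum.inl).union
      ((B.finite_norm_lt n).image Sum.inr)).subset ?_
    rintro (x | x) hx
    · exact .inl ⟨x, hx, rfl⟩
    · exact .inr ⟨x, hx, rfl⟩

/-- The cartesian product `A × B`. -/
def prod (A B : NormedWqo) : NormedWqo where
  carrier := A.carrier × B.carrier
  le x y := A.le x.1 y.1 ∧ B.le x.2 y.2
  norm x := max (A.norm x.1) (B.norm x.2)
  le_refl x := ⟨A.le_refl _, B.le_refl _⟩
  le_trans _ _ _ h₁ h₂ := ⟨A.le_trans _ _ _ h₁.1 h₂.1, B.le_trans _ _ _ h₁.2 h₂.2⟩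
  wqo := by
    have : IsPreorder A.carrier A.le := { refl := A.le_refl, trans := A.le_trans }
    exact A.wqo.prod B.wqo
  finite_norm_lt n := by
    refine ((A.finite_norm_lt n).prod (B.finite_norm_lt n)).subset fun x hx => ?_
    have hx' : max (A.norm x.1) (B.norm x.2) < n := hx
    exact ⟨lt_of_le_of_lt (le_max_left _ _) hx', lt_of_le_of_lt (le_max_right _ _) hx'⟩

/-- The finite subsets of `A` with the majoring ordering `X ⊑ Y ↔ ∀ x ∈ X, ∃ y ∈ Y, x ≤ y`; the
norm of `X` is the maximum of the norms of its elements and of its cardinality. -/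
def majPowerset (A : NormedWqo) : NormedWqo where
  carrier := Finset A.carrier
  le X Y := ∀ x ∈ X, ∃ y ∈ Y, A.le x y
  norm X := max (X.sup A.norm) X.card
  le_refl _ x hx := ⟨x, hx, A.le_refl x⟩
  le_trans _ _ _ h₁ h₂ x hx := by
    obtain ⟨y, hy, hxy⟩ := h₁ x hx
    obtain ⟨z, hz, hyz⟩ := h₂ y hy
    exact ⟨z, hz, A.le_trans _ _ _ hxy hyz⟩
  wqo := by
    classical
    have : IsPreorder A.carrier A.le := { refl := A.le_refl, trans := A.le_trans }
    have h := Set.PartiallyWellOrderedOn.partiallyWellOrderedOn_sublistForall₂ A.le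
      (Set.partiallyWellOrderedOn_univ_iff.2 A.wqo)
    simp only [Set.mem_univ, implies_true] at h
    have h' : WellQuasiOrdered (List.SublistForall₂ A.le) :=
      Set.partiallyWellOrderedOn_univ_iff.1 h
    intro f
    obtain ⟨m, n, hmn, hl⟩ := h' fun i => (f i).toList
    refine ⟨m, n, hmn, fun x hx => ?_⟩
    have aux : ∀ l₁ l₂ : List A.carrier, List.SublistForall₂ A.le l₁ l₂ →
        ∀ x ∈ l₁, ∃ y ∈ l₂, A.le x y := by
      intro l₁ l₂ hl
      induction hl with
      | nil => simp
      | cons h _ ih =>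
        intro x hx
        rcases List.mem_cons.1 hx with rfl | hx
        · exact ⟨_, List.mem_cons_self, h⟩
        · obtain ⟨y, hy, hxy⟩ := ih x hx
          exact ⟨y, List.mem_cons_of_mem _ hy, hxy⟩
      | cons_right _ ih =>
        intro x hx
        obtain ⟨y, hy, hxy⟩ := ih x hx
        exact ⟨y, List.mem_cons_of_mem _ hy, hxy⟩
    obtain ⟨y, hy, hxy⟩ := aux _ _ hl x (Finset.mem_toList.2 hx)
    exact ⟨y, Finset.mem_toList.1 hy, hxy⟩
  finite_norm_lt n := by
    refine (Finset.finite_toSet (A.finite_norm_lt n).toFinset.powerset).subset fun X hX => ?_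
    simp only [Finset.coe_powerset, Set.mem_preimage, Set.mem_powerset_iff]
    intro x hx
    simp only [Set.Finite.coe_toFinset, Set.mem_ofPred_eq]
    exact ((Finset.le_sup (f := A.norm) hx).trans (le_max_left _ _)).trans_lt hX

end NormedWqo

/-! ## Cantor normal forms, natural sums and products

An ordinal `α = ω^β₁ + ⋯ + ω^β_m`, `β₁ ≥ ⋯ ≥ β_m`, is handled through the multiset
`{β₁, …, β_m}` of its exponents. -/

/-- The multiset of exponents of the Cantor normal form of `α`. -/
noncomputable def exps (α : Ordinal.{0}) : Multiset Ordinal.{0} :=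
  if _h : α = 0 then 0 else Ordinal.log ω α ::ₘ exps (α - ω ^ Ordinal.log ω α)
termination_by α
decreasing_by exact Ordinal.sub_omega0_opow_log_lt _h

/-- The ordinal `ω^β₁ + ⋯ + ω^β_m` where `β₁ ≥ ⋯ ≥ β_m` is the decreasing rearrangement of `s`. -/
noncomputable def ofExps (s : Multiset Ordinal.{0}) : Ordinal.{0} :=
  ((s.sort (· ≥ ·)).map (fun β => ω ^ β)).sum

/-- The natural sum `α ⊕ β`. -/
noncomputable def natSum (α β : Ordinal.{0}) : Ordinal.{0} :=
  ofExps (exps α + exps β)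

/-- The natural product `α ⊗ β`: the natural sum of the `ω^(β_i ⊕ β'_j)`. -/
noncomputable def natProd (α β : Ordinal.{0}) : Ordinal.{0} :=
  ofExps ((exps α ×ˢ exps β).map fun p => natSum p.1 p.2)

/-- The natural sum of a finite family. -/
noncomputable def natSumList (s : Multiset Ordinal.{0}) : Ordinal.{0} :=
  ofExps (s.bind exps)

/-- The norm `N` on the ordinals below `ε₀`: the maximum of the coefficients of the strict form
of `α` and of the norms of its exponents. (Below `ε₀` every exponent of `α` is less than `α`, so
the case distinction only serves to make the recursion total.) -/
noncomputable def ordNorm (α : Ordinal.{0}) : ℕ :=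
  (exps α).toFinset.sup fun β =>
    max ((exps α).count β) (if _h : β < α then ordNorm β else 0)
termination_by α

/-- `α` is `k`-lean if `N α ≤ k`. -/
def IsLean (k : ℕ) (α : Ordinal.{0}) : Prop := ordNorm α ≤ k

/-! ### Basic facts on exponents, used for the recursions below -/

theorem exps_zero : exps 0 = 0 := by
  rw [exps]; simp

theorem exps_of_ne_zero {α : Ordinal.{0}} (h : α ≠ 0) :
    exps α = Ordinal.log ω α ::ₘ exps (α - ω ^ Ordinal.log ω α) := by
  rw [exps]; simp [h]

theorem le_log_of_mem_exps (α : Ordinal.{0}) : ∀ β ∈ exps α, β ≤ Ordinal.log ω α := by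
  induction α using WellFoundedLT.induction with
  | ind α ih =>
    intro β hβ
    by_cases h : α = 0
    · subst h; simp [exps_zero] at hβ
    · rw [exps_of_ne_zero h, Multiset.mem_cons] at hβ
      rcases hβ with rfl | hβ
      · exact le_rfl
      · exact (ih _ (Ordinal.sub_omega0_opow_log_lt h) β hβ).trans
          (Ordinal.log_mono_right _ (Ordinal.sub_le_self _ _))

theorem ofExps_zero : ofExps 0 = 0 := by simp [ofExps]

theorem ofExps_cons {b : Ordinal.{0}} {s : Multiset Ordinal.{0}} (h : ∀ x ∈ s, x ≤ b) :
    ofExps (b ::ₘ s) = ω ^ b + ofExps s := by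
  rw [ofExps, Multiset.sort_cons _ _ _ (by simpa using h)]
  simp [ofExps]

/-- Taking the Cantor normal form and evaluating it gives the ordinal back. -/
theorem ofExps_exps (α : Ordinal.{0}) : ofExps (exps α) = α := by
  induction α using WellFoundedLT.induction with
  | ind α ih =>
    by_cases h : α = 0
    · subst h; rw [exps_zero, ofExps_zero]
    · have hle := Ordinal.opow_log_le_self ω h
      rw [exps_of_ne_zero h, ofExps_cons, ih _ (Ordinal.sub_omega0_opow_log_lt h)]
      · exact Ordinal.add_sub_cancel_of_le hle
      · intro x hx
        exact (le_log_of_mem_exps _ x hx).trans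
          (Ordinal.log_mono_right _ (Ordinal.sub_le_self _ _))

/-- Induction on a multiset of ordinals by adjoining an element above all the others. -/
theorem exps_induction {p : Multiset Ordinal.{0} → Prop} (h0 : p 0)
    (hs : ∀ b s, (∀ x ∈ s, x ≤ b) → p s → p (b ::ₘ s)) (s : Multiset Ordinal.{0}) : p s := by
  have key : ∀ l : List Ordinal.{0}, l.Pairwise (· ≥ ·) → p (l : Multiset Ordinal.{0}) := by
    intro l
    induction l with
    | nil => intro _; exact h0
    | cons b l ih =>
      intro hl
      rw [List.pairwise_cons] at hl
      exact hs b l (fun x hx => hl.1 x (by simpa using hx)) (ih hl.2)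
  have := key (s.sort (· ≥ ·)) (Multiset.pairwise_sort _ _)
  rwa [Multiset.sort_eq] at this

theorem ofExps_lt {s : Multiset Ordinal.{0}} {b : Ordinal.{0}} (h : ∀ x ∈ s, x < b) :
    ofExps s < ω ^ b := by
  induction s using exps_induction with
  | h0 => rw [ofExps_zero]; exact Ordinal.opow_pos _ Ordinal.omega0_pos
  | hs c s hc ih =>
    rw [ofExps_cons hc]
    exact Ordinal.isPrincipal_add_omega0_opow b
      ((Ordinal.opow_lt_opow_iff_right Ordinal.one_lt_omega0).2 (h c (Multiset.mem_cons_self _ _)))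
      (ih fun x hx => h x (Multiset.mem_cons_of_mem hx))

/-- Every multiset of ordinals is the multiset of exponents of a Cantor normal form. -/
theorem exps_ofExps (s : Multiset Ordinal.{0}) : exps (ofExps s) = s := by
  induction s using exps_induction with
  | h0 => rw [ofExps_zero, exps_zero]
  | hs b s hb ih =>
    have hlt : ofExps s < ω ^ (b + 1) := ofExps_lt fun x hx => (hb x hx).trans_lt (lt_add_one b)
    have hpos : ω ^ b + ofExps s ≠ 0 := by
      have : 0 < ω ^ b := Ordinal.opow_pos b Ordinal.omega0_pos
      exact (this.trans_le le_self_add).ne'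
    have hlog : Ordinal.log ω (ω ^ b + ofExps s) = b := by
      rw [Ordinal.log_eq_iff Ordinal.one_lt_omega0 hpos]
      refine ⟨le_self_add, ?_⟩
      exact Ordinal.isPrincipal_add_omega0_opow (b + 1)
        ((Ordinal.opow_lt_opow_iff_right Ordinal.one_lt_omega0).2 (lt_add_one b)) hlt
    rw [ofExps_cons hb, exps_of_ne_zero hpos, hlog, Ordinal.add_sub_cancel, ih]

/-- Replacing one exponent by finitely many smaller ones makes the ordinal smaller. -/
theorem ofExps_add_lt {s u : Multiset Ordinal.{0}} {b : Ordinal.{0}} (h : ∀ x ∈ s, x < b) :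
    ofExps (s + u) < ofExps (b ::ₘ u) := by
  induction u using exps_induction with
  | h0 =>
    rw [add_zero, ofExps_cons (by simp), ofExps_zero, add_zero]
    exact ofExps_lt h
  | hs c u hc ih =>
    by_cases hcb : c < b
    · have h1 : ofExps (s + c ::ₘ u) < ω ^ b := by
        refine ofExps_lt fun x hx => ?_
        rcases Multiset.mem_add.1 hx with hx | hx
        · exact h x hx
        · rcases Multiset.mem_cons.1 hx with rfl | hx
          · exact hcb
          · exact (hc x hx).trans_lt hcb
      rw [ofExps_cons (b := b) (s := c ::ₘ u)]
      · exact h1.trans_le le_self_add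
      · intro x hx
        rcases Multiset.mem_cons.1 hx with rfl | hx
        · exact hcb.le
        · exact (hc x hx).trans hcb.le
    · rw [not_lt] at hcb
      rw [Multiset.add_cons, Multiset.cons_swap, ofExps_cons, ofExps_cons]
      · exact add_lt_add_right ih _
      · intro x hx
        rcases Multiset.mem_cons.1 hx with rfl | hx
        · exact hcb
        · exact hc x hx
      · intro x hx
        rcases Multiset.mem_add.1 hx with hx | hx
        · exact (h x hx).le.trans hcb
        · exact hc x hx

theorem exps_opow (b : Ordinal.{0}) : exps (ω ^ b) = {b} := by
  have : ofExps {b} = ω ^ b := by simp [ofExps]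
  rw [← this, exps_ofExps]

theorem ofExps_replicate (m : ℕ) (b : Ordinal.{0}) :
    ofExps (Multiset.replicate m b) = ω ^ b * m := by
  induction m with
  | zero => simp [ofExps_zero]
  | succ m ih =>
    rw [Multiset.replicate_succ, ofExps_cons (fun x hx => (Multiset.eq_of_mem_replicate hx).le), ih]
    rw [add_comm m 1, Nat.cast_add, Nat.cast_one, mul_one_add]

theorem exps_opow_mul_natCast (b : Ordinal.{0}) (m : ℕ) :
    exps (ω ^ b * m) = Multiset.replicate m b := by
  rw [← ofExps_replicate, exps_ofExps]

/-! ## Derivatives -/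

/-- `D_n(ω^(ω^p))`: this is `n + 1` for `p = 0` and `ω^(ω^(p-1) · (p+1) n)` for a natural number
`p > 0`. (The value `0` for infinite `p` is never used below `ω^(ω^ω)`.) -/
noncomputable def derivAtom (n : ℕ) (p : Ordinal.{0}) : Ordinal.{0} :=
  if p = 0 then (n + 1 : ℕ)
  else if p < ω then ω ^ (ω ^ Ordinal.pred p * ((p + 1) * n))
  else 0

/-- `D_n(ω^β)` for `β = ω^p₁ + ⋯ + ω^p_k`: the natural sum over `i` of
`D_n(ω^(ω^p_i)) ⊗ ⨂_{j ≠ i} ω^(ω^p_j)`; the last factor is `ω^(⨁_{j ≠ i} ω^p_j)`.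
In particular `D_n(ω^0) = D_n(1) = 0`. -/
noncomputable def derivPow (n : ℕ) (β : Ordinal.{0}) : Ordinal.{0} :=
  natSumList ((exps β).map fun p => natProd (derivAtom n p) (ω ^ ofExps ((exps β).erase p)))

/-- `∂_n(ω^β₁ + ⋯ + ω^β_m) = {D_n(ω^β_i) ⊕ ⨁_{j ≠ i} ω^β_j | i = 1, …, m}`. -/
noncomputable def derivs (n : ℕ) (α : Ordinal.{0}) : Finset Ordinal.{0} :=
  (exps α).toFinset.image fun β => natSum (derivPow n β) (ofExps ((exps α).erase β))

theorem lt_of_mem_exps_exps_derivAtom {n : ℕ} {p f x : Ordinal.{0}}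
    (hf : f ∈ exps (derivAtom n p)) (hx : x ∈ exps f) : x < p := by
  unfold derivAtom at hf
  split_ifs at hf with h0 hω
  · have h1 : ((n + 1 : ℕ) : Ordinal.{0}) = ω ^ (0 : Ordinal.{0}) * ((n + 1 : ℕ) : Ordinal.{0}) := by
      simp
    rw [h1, exps_opow_mul_natCast] at hf
    rw [Multiset.eq_of_mem_replicate hf, exps_zero] at hx
    simp at hx
  · obtain ⟨m, rfl⟩ := Ordinal.lt_omega0.1 hω
    rcases m with _ | m
    · simp at h0
    · rw [exps_opow, Multiset.mem_singleton] at hf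
      have h2 : (((m + 1 : ℕ) : Ordinal.{0}) + 1) * (n : Ordinal.{0})
          = (((m + 1 + 1) * n : ℕ) : Ordinal.{0}) := by push_cast; rfl
      rw [hf, h2, exps_opow_mul_natCast] at hx
      rw [Multiset.eq_of_mem_replicate hx, Nat.cast_add, Nat.cast_one, Ordinal.pred_add_one]
      exact lt_add_one _
  · rw [exps_zero] at hf
    simp at hf

theorem lt_of_mem_exps_derivPow {n : ℕ} {β x : Ordinal.{0}} (hx : x ∈ exps (derivPow n β)) :
    x < β := by
  unfold derivPow natSumList at hx
  rw [exps_ofExps, Multiset.mem_bind] at hx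
  obtain ⟨y, hy, hxy⟩ := hx
  obtain ⟨p, hp, rfl⟩ := Multiset.mem_map.1 hy
  unfold natProd at hxy
  rw [exps_ofExps, exps_opow, Multiset.mem_map] at hxy
  obtain ⟨⟨f, e⟩, hfe, rfl⟩ := hxy
  rw [Multiset.mem_product, Multiset.mem_singleton] at hfe
  obtain ⟨hf, rfl⟩ := hfe
  have h1 : natSum f (ofExps ((exps β).erase p)) < ofExps (p ::ₘ (exps β).erase p) := by
    unfold natSum
    rw [exps_ofExps]
    exact ofExps_add_lt fun x hx => lt_of_mem_exps_exps_derivAtom hf hx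
  rwa [Multiset.cons_erase hp, ofExps_exps] at h1

/-- Derivatives are smaller ordinals. -/
theorem lt_of_mem_derivs {n : ℕ} {α α' : Ordinal.{0}} (h : α' ∈ derivs n α) : α' < α := by
  obtain ⟨β, hβ, rfl⟩ := Finset.mem_image.1 h
  rw [Multiset.mem_toFinset] at hβ
  have h1 : natSum (derivPow n β) (ofExps ((exps α).erase β)) < ofExps (β ::ₘ (exps α).erase β) := by
    unfold natSum
    rw [exps_ofExps]
    exact ofExps_add_lt fun x hx => lt_of_mem_exps_derivPow hx
  rwa [Multiset.cons_erase hβ, ofExps_exps] at h1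

/-- `M_{α,g}(n) = max_{α' ∈ ∂_n(α)} (1 + M_{α',g}(g(n)))`, the maximum of the empty set
being `0`. -/
noncomputable def boundFn (g : ℕ → ℕ) (α : Ordinal.{0}) (n : ℕ) : ℕ :=
  (derivs n α).attach.sup fun α' => 1 + boundFn g α'.1 (g n)
termination_by α
decreasing_by exact lt_of_mem_derivs α'.2

theorem boundFn_eq (g : ℕ → ℕ) (α : Ordinal.{0}) (n : ℕ) :
    boundFn g α n = (derivs n α).sup fun α' => 1 + boundFn g α' (g n) := by
  rw [boundFn, Finset.sup_attach (derivs n α) fun α' => 1 + boundFn g α' (g n)]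

/-! ## Fundamental sequences and the Cichoń hierarchy -/

/-- The least exponent `β_m` of the Cantor normal form of `α`. -/
noncomputable def lastExp (α : Ordinal.{0}) : Ordinal.{0} := sInf {β | β ∈ exps α}

/-- `α` without the last term of its Cantor normal form: `α = initPart α + ω ^ lastExp α`. -/
noncomputable def initPart (α : Ordinal.{0}) : Ordinal.{0} := ofExps ((exps α).erase (lastExp α))

theorem lastExp_mem {α : Ordinal.{0}} (h : α ≠ 0) : lastExp α ∈ exps α := by
  have hne : {β | β ∈ exps α}.Nonempty := by
    refine ⟨Ordinal.log ω α, ?_⟩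
    change _ ∈ exps α
    rw [exps_of_ne_zero h]
    exact Multiset.mem_cons_self _ _
  exact csInf_mem hne

theorem initPart_add {α : Ordinal.{0}} (h : α ≠ 0) : initPart α + ω ^ lastExp α = α := by
  have key : ∀ s : Multiset Ordinal.{0}, ∀ b, (∀ x ∈ s, b ≤ x) →
      ofExps s + ω ^ b = ofExps (b ::ₘ s) := by
    intro s b hb
    induction s using exps_induction with
    | h0 => rw [ofExps_zero, zero_add, ofExps_cons (by simp), ofExps_zero, add_zero]
    | hs c s hc ih =>
      rw [ofExps_cons hc, add_assoc, ih fun x hx => hb x (Multiset.mem_cons_of_mem hx),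
        Multiset.cons_swap, ofExps_cons (b := c) (s := b ::ₘ s)]
      intro x hx
      rcases Multiset.mem_cons.1 hx with rfl | hx
      · exact hb c (Multiset.mem_cons_self _ _)
      · exact hc x hx
  unfold initPart
  rw [key, Multiset.cons_erase (lastExp_mem h), ofExps_exps]
  intro x hx
  exact csInf_le' (s := {β | β ∈ exps α}) (Multiset.mem_of_mem_erase hx)

/-- The fundamental sequence of a limit ordinal below `ε₀`:
`(γ + ω^(β+1))(x) = γ + ω^β · (x + 1)` and `(γ + ω^λ)(x) = γ + ω^(λ(x))`.
Other ordinals get the value `0`. (The last exponent of a limit ordinal `α < ε₀` is always less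
than `α`; testing this makes the recursion total.) -/
noncomputable def fundSeq (α : Ordinal.{0}) (x : ℕ) : Ordinal.{0} :=
  if lastExp α = 0 then 0
  else if Ordinal.pred (lastExp α) + 1 = lastExp α then
    initPart α + ω ^ Ordinal.pred (lastExp α) * ((x + 1 : ℕ) : Ordinal.{0})
  else if _h : lastExp α < α then initPart α + ω ^ fundSeq (lastExp α) x
  else 0
termination_by α

theorem fundSeq_lt {α : Ordinal.{0}} (h : α ≠ 0) (x : ℕ) : fundSeq α x < α := by
  induction α using WellFoundedLT.induction with
  | ind α ih =>
    rw [fundSeq]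
    split_ifs with h1 h2 h3
    · exact pos_iff_ne_zero.2 h
    · conv_rhs => rw [← initPart_add h]
      refine add_lt_add_right ?_ _
      conv_rhs => rw [← h2]
      exact Ordinal.opow_mul_lt_opow (Ordinal.natCast_lt_omega0 _) (lt_add_one _)
    · conv_rhs => rw [← initPart_add h]
      exact add_lt_add_right
        ((Ordinal.opow_lt_opow_iff_right Ordinal.one_lt_omega0).2 (ih _ h3 h1)) _
    · exact pos_iff_ne_zero.2 h

/-- The predecessor of `α > 0` at `x`: `P_x(α + 1) = α` and `P_x(λ) = P_x(λ(x))`.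
(By convention `P_x(0) = 0`.) -/
noncomputable def predAt (x : ℕ) (α : Ordinal.{0}) : Ordinal.{0} :=
  if _h : α = 0 then 0
  else if Ordinal.pred α + 1 = α then Ordinal.pred α
  else predAt x (fundSeq α x)
termination_by α
decreasing_by exact fundSeq_lt _h x

theorem predAt_lt {α : Ordinal.{0}} (h : α ≠ 0) (x : ℕ) : predAt x α < α := by
  induction α using WellFoundedLT.induction with
  | ind α ih =>
    rw [predAt, dif_neg h]
    split_ifs with h2
    · conv_rhs => rw [← h2]
      exact lt_add_one _
    · by_cases h3 : fundSeq α x = 0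
      · rw [h3, predAt]; simpa using pos_iff_ne_zero.2 h
      · exact (ih _ (fundSeq_lt h x) h3).trans (fundSeq_lt h x)

/-- The Cichoń hierarchy of `h`: `h_0(x) = 0` and `h_α(x) = 1 + h_{P_x(α)}(h(x))` for `α > 0`. -/
noncomputable def cichon (h : ℕ → ℕ) (α : Ordinal.{0}) (x : ℕ) : ℕ :=
  if _hα : α = 0 then 0 else 1 + cichon h (predAt x α) (h x)
termination_by α
decreasing_by exact predAt_lt _hα x

/-! ## The majoring powerset nwqos -/

/-- The family built from `P_f(ℕ^d)` (`d > 0`), `Γ_0` and `Γ_1` by disjoint sums and cartesian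
products. -/
inductive MajNwqo : Type
  | gamma0 : MajNwqo
  | gamma1 : MajNwqo
  | pow (d : ℕ) (hd : 0 < d) : MajNwqo
  | sum (A B : MajNwqo) : MajNwqo
  | prod (A B : MajNwqo) : MajNwqo

namespace MajNwqo

/-- The normed wqo that an expression denotes. -/
def toNwqo : MajNwqo → NormedWqo
  | gamma0 => NormedWqo.gamma 0
  | gamma1 => NormedWqo.gamma 1
  | pow d _ => (NormedWqo.natPow d).majPowerset
  | sum A B => A.toNwqo.sum B.toNwqo
  | prod A B => A.toNwqo.prod B.toNwqo

/-- The order type `o(A)`. -/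
noncomputable def orderType : MajNwqo → Ordinal.{0}
  | gamma0 => 0
  | gamma1 => 1
  | pow d _ => ω ^ (ω ^ ((d - 1 : ℕ) : Ordinal.{0}))
  | sum A B => natSum A.orderType B.orderType
  | prod A B => natProd A.orderType B.orderType

end MajNwqo

end MajoringPowerset

/-!
The proof has two independent halves.

*Bounding lengths by derivatives.* After its first entry `x`, a bad sequence over `A` stays in the
residual `{y | ¬ x ≤ y}`. The residual reflects, without increasing norms, into a majoring powerset
nwqo whose order type belongs to `∂_n(o(A))` (`MajNwqo.exists_residual`), so that induction on `o(A)`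
bounds the lengths (`MajNwqo.length_le_boundFn`). For `P_f(ℕ^d)` and `|X| ≤ n`, an element of a set
`Y` not above `X` has a coordinate with a value `c < n`, and for `d ≥ 2` such a `Y` is determined by
its `d * n` slices in `P_f(ℕ^(d-1))`, while for `d = 1` there are `n + 1` classes of them.
For sums and products one keeps track of the summand of order type `ω^β` that contains `x`
(`MajNwqo.exists_splits`); there the residual of a product is governed by the Leibniz rule
`derivPow_natSum`.

*Bounding derivatives by the Cichoń hierarchy.* The ordinal `P_x(α)` is at least every `x`-lean
ordinal below `α` (`le_predAt_of_ordNorm_le`), and `P_x(α)` has norm at most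
`max (N α) (x + 1)` (`ordNorm_predAt_le`). Since `h(y) > y` for `y > 0`, it follows that
`h_α'(y) ≤ h_α(y)` for `α' ≤ α` as soon as `α'` is `y`-lean (`cichon_le_cichon`). Elements of `∂_n(α)` are `4 * k * n`-lean for `α` `k`-lean
(`ordNorm_le_of_mem_derivs`), so each unfolding of `M` is matched by one of the hierarchy
(`boundFn_le_cichon`).
-/

namespace MajoringPowerset

/-! ### Calculus of exponent multisets -/

theorem exps_injective : Function.Injective exps := fun α β h => by
  rw [← ofExps_exps α, h, ofExps_exps]

theorem exps_one : exps 1 = {0} := by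
  rw [← opow_zero ω, exps_opow]

theorem exps_natCast (m : ℕ) : exps m = Multiset.replicate m 0 := by
  have h := exps_opow_mul_natCast 0 m
  rwa [opow_zero, one_mul] at h

theorem exps_natSum (α β : Ordinal.{0}) : exps (natSum α β) = exps α + exps β :=
  exps_ofExps _

theorem exps_natProd (α β : Ordinal.{0}) :
    exps (natProd α β) = (exps α ×ˢ exps β).map fun p => natSum p.1 p.2 :=
  exps_ofExps _

theorem natSum_comm (α β : Ordinal.{0}) : natSum α β = natSum β α := by
  rw [natSum, add_comm, natSum]

theorem natSum_zero (α : Ordinal.{0}) : natSum α 0 = α :=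
  exps_injective (by rw [exps_natSum, exps_zero, add_zero])

theorem natProd_comm (α β : Ordinal.{0}) : natProd α β = natProd β α := by
  apply exps_injective
  rw [exps_natProd, exps_natProd, ← Multiset.map_swap_product, Multiset.map_map]
  exact Multiset.map_congr rfl fun p _ => natSum_comm _ _

theorem exps_natProd_opow (α β : Ordinal.{0}) :
    exps (natProd α (ω ^ β)) = (exps α).map fun γ => natSum γ β := by
  rw [exps_natProd, exps_opow, ← Multiset.cons_zero, Multiset.product_cons, Multiset.product_zero,
    add_zero, Multiset.map_map]
  rfl

theorem natProd_opow_opow (α β : Ordinal.{0}) :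
    natProd (ω ^ α) (ω ^ β) = ω ^ natSum α β :=
  exps_injective (by rw [exps_natProd_opow, exps_opow, exps_opow, Multiset.map_singleton])

theorem lt_opow_of_exps_lt {α b : Ordinal.{0}} (h : ∀ x ∈ exps α, x < b) : α < ω ^ b := by
  rw [← ofExps_exps α]
  exact ofExps_lt h

theorem opow_le_of_mem_exps {α β : Ordinal.{0}} (h : β ∈ exps α) : ω ^ β ≤ α := by
  have h0 : α ≠ 0 := by
    rintro rfl
    simp [exps_zero] at h
  exact (Ordinal.opow_le_opow_right omega0_pos (le_log_of_mem_exps α β h)).trans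
    (opow_log_le_self ω h0)

theorem exps_lt_of_lt_opow {α b x : Ordinal.{0}} (h : α < ω ^ b) (hx : x ∈ exps α) : x < b :=
  (opow_lt_opow_iff_right one_lt_omega0).1 ((opow_le_of_mem_exps hx).trans_lt h)

theorem natSum_lt_opow {α β b : Ordinal.{0}} (hα : α < ω ^ b) (hβ : β < ω ^ b) :
    natSum α β < ω ^ b := by
  refine lt_opow_of_exps_lt fun x hx => ?_
  rw [exps_natSum, Multiset.mem_add] at hx
  exact hx.elim (exps_lt_of_lt_opow hα) (exps_lt_of_lt_opow hβ)

theorem natProd_lt_opow_opow {α β b : Ordinal.{0}} (hα : α < ω ^ ω ^ b) (hβ : β < ω ^ ω ^ b) :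
    natProd α β < ω ^ ω ^ b := by
  refine lt_opow_of_exps_lt fun x hx => ?_
  rw [exps_natProd, Multiset.mem_map] at hx
  obtain ⟨p, hp, rfl⟩ := hx
  rw [Multiset.mem_product] at hp
  exact natSum_lt_opow (exps_lt_of_lt_opow hα hp.1) (exps_lt_of_lt_opow hβ hp.2)

theorem ofExps_add {s t : Multiset Ordinal.{0}} (h : ∀ a ∈ s, ∀ b ∈ t, b ≤ a) :
    ofExps (s + t) = ofExps s + ofExps t := by
  induction s using exps_induction with
  | h0 => rw [zero_add, ofExps_zero, zero_add]
  | hs c s hc ih =>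
    rw [Multiset.cons_add, ofExps_cons, ofExps_cons hc,
      ih fun a ha => h a (Multiset.mem_cons_of_mem ha), add_assoc]
    intro x hx
    rcases Multiset.mem_add.1 hx with hx | hx
    · exact hc x hx
    · exact h c (Multiset.mem_cons_self _ _) x hx

theorem exps_add {α β : Ordinal.{0}} (h : ∀ a ∈ exps α, ∀ b ∈ exps β, b ≤ a) :
    exps (α + β) = exps α + exps β := by
  rw [← exps_ofExps (exps α + exps β), ofExps_add h, ofExps_exps, ofExps_exps]

theorem exps_add_one (α : Ordinal.{0}) : exps (α + 1) = 0 ::ₘ exps α := by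
  rw [exps_add, exps_one, add_comm, Multiset.singleton_add]
  intro a _ b hb
  rw [exps_one, Multiset.mem_singleton] at hb
  exact hb ▸ zero_le

/-- An ordinal with no exponent above `c`, and with `ω ^ c` occurring at most `m` times, is less
than `ω ^ c * (m + 1)`. -/
theorem lt_opow_mul_of_count_le {α c : Ordinal.{0}} {m : ℕ} (hle : ∀ x ∈ exps α, x ≤ c)
    (hcount : (exps α).count c ≤ m) : α < ω ^ c * ((m + 1 : ℕ) : Ordinal.{0}) := by
  have hsplit : exps α = Multiset.replicate ((exps α).count c) c
      + (exps α).filter fun x => ¬ c = x := by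
    rw [← Multiset.filter_eq, Multiset.filter_add_not]
  have hα : α = ω ^ c * ((exps α).count c : Ordinal.{0})
      + ofExps ((exps α).filter fun x => ¬ c = x) := by
    conv_lhs => rw [← ofExps_exps α, hsplit]
    rw [ofExps_add, ofExps_replicate]
    intro a ha b hb
    rw [Multiset.eq_of_mem_replicate ha]
    exact hle b (Multiset.mem_of_mem_filter hb)
  have hlt : ofExps ((exps α).filter fun x => ¬ c = x) < ω ^ c := by
    refine ofExps_lt fun x hx => ?_
    rw [Multiset.mem_filter] at hx
    exact lt_of_le_of_ne (hle x hx.1) (Ne.symm hx.2)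
  calc α < ω ^ c * ((exps α).count c : Ordinal.{0}) + ω ^ c := by
        conv_lhs => rw [hα]
        exact add_lt_add_right hlt _
    _ ≤ ω ^ c * (m : Ordinal.{0}) + ω ^ c := by gcongr
    _ = ω ^ c * ((m + 1 : ℕ) : Ordinal.{0}) := by
        rw [Nat.cast_add, Nat.cast_one, mul_add_one]

/-! ### Ordinals below `ε₀` and their norm -/

theorem lt_of_mem_exps {α β : Ordinal.{0}} (hα : α < ε₀) (h : β ∈ exps α) : β < α := by
  refine lt_of_lt_of_le ?_ (opow_le_of_mem_exps h)
  by_contra hle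
  have h1 : ε₀ ≤ β := epsilon_zero_le_of_omega0_opow_le (not_lt.1 hle)
  exact absurd ((right_le_opow β one_lt_omega0).trans (opow_le_of_mem_exps h))
    (not_le.2 (hα.trans_le h1))

theorem ordNorm_le_iff {α : Ordinal.{0}} (hα : α < ε₀) {k : ℕ} :
    ordNorm α ≤ k ↔ ∀ β ∈ exps α, (exps α).count β ≤ k ∧ ordNorm β ≤ k := by
  rw [ordNorm, Finset.sup_le_iff]
  simp only [Multiset.mem_toFinset]
  refine forall₂_congr fun β hβ => ?_
  rw [dif_pos (lt_of_mem_exps hα hβ), max_le_iff]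

theorem count_le_ordNorm {α : Ordinal.{0}} (hα : α < ε₀) (β : Ordinal.{0}) :
    (exps α).count β ≤ ordNorm α := by
  by_cases h : β ∈ exps α
  · exact ((ordNorm_le_iff hα).1 le_rfl β h).1
  · rw [Multiset.count_eq_zero_of_notMem h]
    exact Nat.zero_le _

theorem ordNorm_le_of_mem_exps {α β : Ordinal.{0}} (hα : α < ε₀) (h : β ∈ exps α) :
    ordNorm β ≤ ordNorm α :=
  ((ordNorm_le_iff hα).1 le_rfl β h).2

theorem eq_zero_of_ordNorm_eq_zero {α : Ordinal.{0}} (hα : α < ε₀) (h : ordNorm α = 0) :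
    α = 0 := by
  have h1 : exps α = 0 := by
    refine Multiset.eq_zero_of_forall_notMem fun β hβ => ?_
    have := count_le_ordNorm hα β
    have := Multiset.count_pos.2 hβ
    omega
  rw [← ofExps_exps α, h1, ofExps_zero]

theorem ordNorm_zero : ordNorm 0 = 0 := by
  rw [ordNorm, exps_zero]
  simp

theorem ordNorm_natCast (m : ℕ) : ordNorm m = m := by
  have hlt : (m : Ordinal.{0}) < ε₀ := natCast_lt_epsilon m 0
  apply le_antisymm
  · rw [ordNorm_le_iff hlt, exps_natCast]
    intro β hβ
    rw [Multiset.eq_of_mem_replicate hβ, Multiset.count_replicate_self, ordNorm_zero]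
    exact ⟨le_rfl, Nat.zero_le _⟩
  · have := count_le_ordNorm hlt 0
    rwa [exps_natCast, Multiset.count_replicate_self] at this

theorem ordNorm_le_ordNorm_add_one {α : Ordinal.{0}} (hα : α + 1 < ε₀) :
    ordNorm α ≤ ordNorm (α + 1) := by
  rw [ordNorm_le_iff ((lt_add_one α).trans hα)]
  intro β hβ
  have hβ' : β ∈ exps (α + 1) := by
    rw [exps_add_one]
    exact Multiset.mem_cons_of_mem hβ
  refine ⟨?_, ordNorm_le_of_mem_exps hα hβ'⟩
  refine le_trans ?_ (count_le_ordNorm hα β)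
  rw [exps_add_one]
  exact Multiset.count_le_count_cons _ _ _

/-! ### Fundamental sequences, predecessors and lean ordinals -/

theorem lastExp_le {α β : Ordinal.{0}} (h : β ∈ exps α) : lastExp α ≤ β :=
  csInf_le' (s := {β | β ∈ exps α}) h

theorem exps_initPart (α : Ordinal.{0}) : exps (initPart α) = (exps α).erase (lastExp α) :=
  exps_ofExps _

theorem lastExp_le_of_mem_exps_initPart {α β : Ordinal.{0}} (h : β ∈ exps (initPart α)) :
    lastExp α ≤ β := by
  rw [exps_initPart] at h
  exact lastExp_le (Multiset.mem_of_mem_erase h)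

/-- Below `ε₀`, an ordinal less than `α` is less than `initPart α`, or it continues `initPart α`
with a tail whose exponents are smaller than the last exponent of `α`. -/
theorem lt_initPart_or_eq_add {α α' : Ordinal.{0}} (hα : α ≠ 0) (h : α' < α) :
    α' < initPart α ∨ ∃ δ, α' = initPart α + δ ∧ (∀ c ∈ exps δ, c < lastExp α) ∧
      exps δ ≤ exps α' := by
  rcases lt_or_ge α' (initPart α) with h1 | h1
  · exact .inl h1
  · refine .inr ⟨α' - initPart α, (Ordinal.add_sub_cancel_of_le h1).symm, ?_⟩
    have h2 : initPart α + (α' - initPart α) < initPart α + ω ^ lastExp α := by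
      rwa [Ordinal.add_sub_cancel_of_le h1, initPart_add hα]
    have h3 : ∀ c ∈ exps (α' - initPart α), c < lastExp α := fun c hc =>
      exps_lt_of_lt_opow ((add_lt_add_iff_left _).1 h2) hc
    refine ⟨h3, ?_⟩
    conv_rhs => rw [← Ordinal.add_sub_cancel_of_le h1]
    rw [exps_add fun a ha b hb => (h3 b hb).le.trans (lastExp_le_of_mem_exps_initPart ha)]
    exact Multiset.le_add_left _ _

theorem pred_add_one_of_lastExp_eq_zero {α : Ordinal.{0}} (hα : α ≠ 0) (h : lastExp α = 0) :
    Ordinal.pred α + 1 = α := by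
  have h1 := initPart_add hα
  rw [h, opow_zero] at h1
  rw [← h1, pred_add_one]

/-- An `x`-lean ordinal below a limit `α < ε₀` is already below the `x`-th element of the
fundamental sequence of `α`. -/
theorem lt_fundSeq_of_ordNorm_le {x : ℕ} {α : Ordinal.{0}} (hα : α < ε₀)
    (hlim : ¬ Ordinal.pred α + 1 = α) (h0 : α ≠ 0) :
    ∀ {α' : Ordinal.{0}}, α' < α → ordNorm α' ≤ x → α' < fundSeq α x := by
  induction α using WellFoundedLT.induction with
  | ind α ih =>
    intro α' h hN
    have hlast : lastExp α ≠ 0 := fun hl => hlim (pred_add_one_of_lastExp_eq_zero h0 hl)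
    have hlt : lastExp α < α := lt_of_mem_exps hα (lastExp_mem h0)
    have hα' : α' < ε₀ := h.trans hα
    rw [fundSeq, if_neg hlast]
    rcases lt_initPart_or_eq_add h0 h with h1 | ⟨δ, rfl, hδ, hsub⟩
    · split_ifs
      · exact h1.trans_le le_self_add
      · exact h1.trans_le le_self_add
    · split_ifs with h2
      · refine add_lt_add_right (lt_opow_mul_of_count_le (fun c hc => ?_) ?_) _
        · have := hδ c hc
          rw [← h2] at this
          exact Order.lt_add_one_iff.1 this
        · exact (Multiset.count_le_of_le _ hsub).trans ((count_le_ordNorm hα' _).trans hN)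
      · refine add_lt_add_right (lt_opow_of_exps_lt fun c hc => ?_) _
        exact ih _ hlt (hlt.trans hα) h2 hlast (hδ c hc)
          ((ordNorm_le_of_mem_exps hα' (Multiset.mem_of_le hsub hc)).trans hN)

/-- `P_x(α)` is at least every `x`-lean ordinal below `α`. -/
theorem le_predAt_of_ordNorm_le {x : ℕ} {α : Ordinal.{0}} (hα : α < ε₀) :
    ∀ {α' : Ordinal.{0}}, α' < α → ordNorm α' ≤ x → α' ≤ predAt x α := by
  induction α using WellFoundedLT.induction with
  | ind α ih =>
    intro α' h hN
    have h0 : α ≠ 0 := (h.trans_le' zero_le).ne'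
    rw [predAt, dif_neg h0]
    split_ifs with h1
    · rw [← h1] at h
      exact Order.lt_add_one_iff.1 h
    · have hlt := fundSeq_lt h0 x
      exact ih _ hlt (hlt.trans hα) (lt_fundSeq_of_ordNorm_le hα h1 h0 h hN) hN

theorem ordNorm_fundSeq_le {x : ℕ} {α : Ordinal.{0}} (h0 : α ≠ 0) (hα : α < ε₀) :
    ordNorm (fundSeq α x) ≤ max (ordNorm α) (x + 1) := by
  induction α using WellFoundedLT.induction with
  | ind α ih =>
    have hmem := lastExp_mem h0
    have hlt : lastExp α < α := lt_of_mem_exps hα hmem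
    have hlt' := (fundSeq_lt h0 x).trans hα
    -- the terms of the fundamental sequence replace the last exponent by copies of a smaller one
    have key : ∀ c m, c < lastExp α → ordNorm c ≤ max (ordNorm α) (x + 1) → m ≤ x + 1 →
        fundSeq α x = initPart α + ω ^ c * ((m : ℕ) : Ordinal.{0}) →
        ordNorm (fundSeq α x) ≤ max (ordNorm α) (x + 1) := by
      intro c m hc hNc hm heq
      have hexps : exps (fundSeq α x) = (exps α).erase (lastExp α) + Multiset.replicate m c := by
        rw [heq, exps_add, exps_initPart, exps_opow_mul_natCast]
        intro a ha b hb
        rw [exps_opow_mul_natCast] at hb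
        rw [Multiset.eq_of_mem_replicate hb]
        exact hc.le.trans (lastExp_le_of_mem_exps_initPart ha)
      have hcnot : c ∉ (exps α).erase (lastExp α) := fun h =>
        (lastExp_le (Multiset.mem_of_mem_erase h)).not_gt hc
      rw [ordNorm_le_iff hlt', hexps]
      intro β hβ
      rw [Multiset.count_add]
      by_cases hβc : β = c
      · subst hβc
        rw [Multiset.count_eq_zero_of_notMem hcnot, Multiset.count_replicate_self, zero_add]
        exact ⟨hm.trans (le_max_right _ _), hNc⟩
      · have hβ1 : β ∉ Multiset.replicate m c := fun h => hβc (Multiset.eq_of_mem_replicate h)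
        have hβ2 := (Multiset.mem_add.1 hβ).resolve_right hβ1
        rw [Multiset.count_eq_zero_of_notMem hβ1, add_zero]
        exact ⟨(Multiset.count_le_of_le _ (Multiset.erase_le _ _)).trans
            ((count_le_ordNorm hα β).trans (le_max_left _ _)),
          (ordNorm_le_of_mem_exps hα (Multiset.mem_of_mem_erase hβ2)).trans (le_max_left _ _)⟩
    have hNlast := ordNorm_le_of_mem_exps hα hmem
    by_cases hlast : lastExp α = 0
    · rw [fundSeq, if_pos hlast, ordNorm_zero]
      exact Nat.zero_le _
    · by_cases h2 : Ordinal.pred (lastExp α) + 1 = lastExp α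
      · refine key (Ordinal.pred (lastExp α)) (x + 1) ?_ ?_ le_rfl ?_
        · conv_rhs => rw [← h2]
          exact lt_add_one _
        · refine le_trans ?_ (hNlast.trans (le_max_left _ _))
          conv_rhs => rw [← h2]
          exact ordNorm_le_ordNorm_add_one (h2.symm ▸ hlt.trans hα)
        · rw [fundSeq, if_neg hlast, if_pos h2]
      · refine key (fundSeq (lastExp α) x) 1 (fundSeq_lt hlast x) ?_ (by omega) ?_
        · exact (ih _ hlt hlast (hlt.trans hα)).trans (max_le_max hNlast le_rfl)
        · rw [fundSeq, if_neg hlast, if_neg h2, dif_pos hlt, Nat.cast_one, mul_one]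

theorem ordNorm_predAt_le {x : ℕ} {α : Ordinal.{0}} (hα : α < ε₀) :
    ordNorm (predAt x α) ≤ max (ordNorm α) (x + 1) := by
  induction α using WellFoundedLT.induction with
  | ind α ih =>
    rw [predAt]
    split_ifs with h0 h1
    · rw [ordNorm_zero]
      exact Nat.zero_le _
    · refine le_trans ?_ (le_max_left _ _)
      conv_rhs => rw [← h1]
      exact ordNorm_le_ordNorm_add_one (h1.symm ▸ hα)
    · have hlt := fundSeq_lt h0 x
      refine (ih _ hlt (hlt.trans hα)).trans (max_le (ordNorm_fundSeq_le h0 hα) (le_max_right _ _))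

/-! ### The Cichoń hierarchy at lean ordinals -/

/-- The Cichoń hierarchy is monotone in the ordinal as long as the smaller ordinal is lean for the
argument. The control function need not be monotone: only `y < h y` matters, which keeps the
predecessors of the smaller ordinal lean. -/
theorem cichon_le_cichon {h : ℕ → ℕ} (hh : ∀ y, 0 < y → y < h y) {α' : Ordinal.{0}} :
    ∀ {α : Ordinal.{0}}, α < ε₀ → α' ≤ α → ∀ {y : ℕ}, 0 < y → ordNorm α' ≤ y →
      cichon h α' y ≤ cichon h α y := by
  induction α' using WellFoundedLT.induction with
  | ind α' ih =>
    intro α hα hle y hy hN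
    rcases hle.eq_or_lt with rfl | hlt
    · exact le_rfl
    by_cases h0 : α' = 0
    · rw [cichon, dif_pos h0]
      exact Nat.zero_le _
    have hα0 : α ≠ 0 := (hlt.trans_le' zero_le).ne'
    have hα' := hlt.trans hα
    rw [cichon, dif_neg h0]
    conv_rhs => rw [cichon, dif_neg hα0]
    have h1 : predAt y α' ≤ predAt y α :=
      (predAt_lt h0 y).le.trans (le_predAt_of_ordNorm_le hα hlt hN)
    have h2 : ordNorm (predAt y α') ≤ h y := by
      have := ordNorm_predAt_le (x := y) hα'
      have := hh y hy
      omega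
    exact Nat.add_le_add_left
      (ih _ (predAt_lt h0 y) ((predAt_lt hα0 y).trans hα) h1 ((Nat.zero_le y).trans_lt (hh y hy))
        h2) 1

/-! ### Exponents and norms of derivatives -/

theorem derivAtom_zero (n : ℕ) : derivAtom n 0 = ((n + 1 : ℕ) : Ordinal.{0}) := by
  rw [derivAtom, if_pos rfl]

theorem derivAtom_add_one (n q : ℕ) :
    derivAtom n ((q + 1 : ℕ) : Ordinal.{0})
      = ω ^ (ω ^ (q : Ordinal.{0}) * (((q + 2) * n : ℕ) : Ordinal.{0})) := by
  rw [derivAtom, if_neg (Nat.cast_ne_zero.2 q.succ_ne_zero), if_pos (natCast_lt_omega0 _)]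
  have h : (((q + 1 : ℕ) : Ordinal.{0}) + 1) * (n : Ordinal.{0})
      = (((q + 2) * n : ℕ) : Ordinal.{0}) := by
    push_cast
    rw [add_assoc, one_add_one_eq_two]
  rw [h, Nat.cast_add, Nat.cast_one, pred_add_one]

theorem exps_derivPow (n : ℕ) (β : Ordinal.{0}) :
    exps (derivPow n β) = (exps β).bind fun p =>
      (exps (derivAtom n p)).map fun γ => natSum γ (ofExps ((exps β).erase p)) := by
  rw [derivPow, natSumList, exps_ofExps, Multiset.bind_map]
  exact Multiset.bind_congr fun p _ => exps_natProd_opow _ _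

theorem derivPow_opow (n : ℕ) (p : Ordinal.{0}) :
    derivPow n (ω ^ p) = derivAtom n p := by
  apply exps_injective
  rw [exps_derivPow, exps_opow, Multiset.singleton_bind, ← Multiset.cons_zero,
    Multiset.erase_cons_head, ofExps_zero]
  simp only [natSum_zero, Multiset.map_id']

theorem derivPow_zero (n : ℕ) : derivPow n 0 = 0 := by
  apply exps_injective
  rw [exps_derivPow, exps_zero, Multiset.zero_bind]

/-- The Leibniz rule `D_n(ω^(β ⊕ β')) = D_n(ω^β) ⊗ ω^β' ⊕ ω^β ⊗ D_n(ω^β')`. -/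
theorem derivPow_natSum (n : ℕ) (β β' : Ordinal.{0}) :
    derivPow n (natSum β β')
      = natSum (natProd (derivPow n β) (ω ^ β')) (natProd (ω ^ β) (derivPow n β')) := by
  have key : ∀ β β' : Ordinal.{0}, ((exps β).bind fun p => (exps (derivAtom n p)).map fun γ =>
        natSum γ (ofExps ((exps β + exps β').erase p)))
      = exps (natProd (derivPow n β) (ω ^ β')) := by
    intro β β'
    rw [exps_natProd_opow, exps_derivPow, Multiset.map_bind]
    refine Multiset.bind_congr fun p hp => ?_
    rw [Multiset.map_map]
    refine Multiset.map_congr rfl fun γ _ => exps_injective ?_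
    rw [Function.comp_apply, exps_natSum, exps_natSum, exps_natSum, exps_ofExps, exps_ofExps,
      Multiset.erase_add_left_pos _ hp, add_assoc]
  apply exps_injective
  rw [exps_derivPow, exps_natSum, Multiset.add_bind, exps_natSum, key β β',
    add_comm (exps β), key β' β, natProd_comm (ω ^ β)]

/-- The exponents of `D_n(ω^(ω^p))`, `p` finite, are copies of a single ordinal. -/
theorem exists_exps_derivAtom (n p : ℕ) : ∃ e m, m ≤ n + 1 ∧
    exps (derivAtom n (p : Ordinal.{0})) = Multiset.replicate m e ∧
    ∀ x ∈ exps e, x < p ∧ (exps e).count x ≤ (p + 1) * n ∧ ordNorm x ≤ p := by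
  rcases p with _ | q
  · refine ⟨0, n + 1, le_rfl, ?_, ?_⟩
    · rw [Nat.cast_zero, derivAtom_zero, exps_natCast]
    · simp [exps_zero]
  · refine ⟨ω ^ (q : Ordinal.{0}) * (((q + 2) * n : ℕ) : Ordinal.{0}), 1, by omega, ?_, ?_⟩
    · rw [derivAtom_add_one, exps_opow, Multiset.replicate_one]
    · intro x hx
      rw [exps_opow_mul_natCast] at hx ⊢
      rw [Multiset.eq_of_mem_replicate hx, Multiset.count_replicate_self, ordNorm_natCast]
      exact ⟨by exact_mod_cast q.lt_succ_self, le_rfl, q.le_succ⟩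

theorem omega0_tower_lt_epsilon_zero : ω ^ ω ^ ω < ε₀ := by
  have := iterate_omega0_opow_lt_epsilon_zero 4
  simpa using this

/-- The exponents contributed by different atoms of `β` are different, so that multiplicities in
`D_n(ω^β)` do not add up over the atoms. -/
theorem derivPow_bounds {k n : ℕ} {β : Ordinal.{0}} (hβ : β < ω ^ ω) (hk : ordNorm β ≤ k)
    (hk0 : 0 < k) (hn : 0 < n) :
    ∀ γ ∈ exps (derivPow n β),
      (exps (derivPow n β)).count γ ≤ (n + 1) * k ∧ ordNorm γ ≤ 3 * k * n := by
  have hωω : ω ^ ω ≤ (ε₀ : Ordinal.{0}) := by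
    refine le_trans ?_ omega0_tower_lt_epsilon_zero.le
    exact Ordinal.opow_le_opow_right omega0_pos (right_le_opow _ one_lt_omega0)
  have hβε := hβ.trans_le hωω
  have hnat : ∀ p ∈ exps β, ∃ m : ℕ, p = m := fun p hp =>
    lt_omega0.1 (exps_lt_of_lt_opow hβ hp)
  have hatom : ∀ p : Ordinal.{0}, ∃ e m, p ∈ exps β → m ≤ n + 1 ∧
      exps (derivAtom n p) = Multiset.replicate m e ∧
      ∀ x ∈ exps e, x < p ∧ (exps e).count x ≤ (k + 1) * n ∧ ordNorm x ≤ k := by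
    intro p
    by_cases hp : p ∈ exps β
    · obtain ⟨q, rfl⟩ := hnat p hp
      have hq : q ≤ k := by
        rw [← ordNorm_natCast q]
        exact (ordNorm_le_of_mem_exps hβε hp).trans hk
      obtain ⟨e, m, hm, he, h⟩ := exists_exps_derivAtom n q
      refine ⟨e, m, fun _ => ⟨hm, he, fun x hx => ⟨(h x hx).1, (h x hx).2.1.trans ?_,
        (h x hx).2.2.trans hq⟩⟩⟩
      gcongr
    · exact ⟨0, 0, fun h => absurd h hp⟩
  choose e m hem using hatom
  set f : Ordinal.{0} → Ordinal.{0} := fun p => natSum (e p) (ofExps ((exps β).erase p)) with hf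
  have hexps : exps (derivPow n β) = (exps β).bind fun p => Multiset.replicate (m p) (f p) := by
    rw [exps_derivPow]
    refine Multiset.bind_congr fun p hp => ?_
    rw [(hem p hp).2.1, Multiset.map_replicate]
  have hfexps : ∀ p, exps (f p) = exps (e p) + (exps β).erase p := fun p => by
    rw [hf, exps_natSum, exps_ofExps]
  -- compared with `β`, the ordinal `f p` has one exponent `p` less, and equally many copies of each
  -- larger exponent
  have hne : ∀ p ∈ exps β, ∀ q ∈ exps β, p < q → f p ≠ f q := by
    intro p hp q hq hpq h
    have hc := congrArg (fun x => (exps x).count q) h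
    have hqp : q ∉ exps (e p) := fun hx => hpq.not_gt ((hem p hp).2.2 q hx).1
    have hqq : q ∉ exps (e q) := fun hx => lt_irrefl _ ((hem q hq).2.2 q hx).1
    simp only [hfexps, Multiset.count_add, Multiset.count_eq_zero_of_notMem hqp,
      Multiset.count_eq_zero_of_notMem hqq, Multiset.count_erase_self,
      Multiset.count_erase_of_ne hpq.ne'] at hc
    have := Multiset.count_pos.2 hq
    omega
  have hinj : ∀ p ∈ exps β, ∀ q ∈ exps β, f p = f q → p = q := by
    intro p hp q hq h
    rcases lt_trichotomy p q with hpq | hpq | hpq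
    · exact absurd h (hne p hp q hq hpq)
    · exact hpq
    · exact absurd h.symm (hne q hq p hp hpq)
  intro γ hγ
  rw [hexps] at hγ ⊢
  obtain ⟨p, hp, hγp⟩ := Multiset.mem_bind.1 hγ
  obtain rfl := Multiset.eq_of_mem_replicate hγp
  have hcount : ∀ q, (exps β).count q ≤ k := fun q => (count_le_ordNorm hβε q).trans hk
  constructor
  · rw [Multiset.count_bind]
    calc ((exps β).map fun q => (Multiset.replicate (m q) (f q)).count (f p)).sum
        ≤ ((exps β).map fun q => (n + 1) * if p = q then 1 else 0).sum := by
          refine Multiset.sum_map_le_sum_map _ _ fun q hq => ?_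
          rw [Multiset.count_replicate]
          by_cases h : f q = f p
          · rw [if_pos h, if_pos (hinj q hq p hp h).symm, mul_one]
            exact (hem q hq).1
          · rw [if_neg h]
            exact Nat.zero_le _
      _ = (n + 1) * (exps β).count p := by
          simp only [Multiset.sum_map_mul_left, ← Multiset.count_singleton]
          rw [← Multiset.count_bind, Multiset.bind_singleton, Multiset.map_id']
      _ ≤ (n + 1) * k := Nat.mul_le_mul_left _ (hcount p)
  · have hfε : f p < ε₀ := by
      refine lt_of_lt_of_le (lt_opow_of_exps_lt fun x hx => ?_) hωω
      rw [hfexps, Multiset.mem_add] at hx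
      rcases hx with hx | hx
      · exact ((hem p hp).2.2 x hx).1.trans (exps_lt_of_lt_opow hβ hp)
      · exact exps_lt_of_lt_opow hβ (Multiset.mem_of_mem_erase hx)
    have hkn : (k + 1) * n + k ≤ 3 * k * n := by nlinarith
    have hkk : k ≤ 3 * k * n := by nlinarith
    rw [ordNorm_le_iff hfε, hfexps]
    intro x hx
    constructor
    · rw [Multiset.count_add]
      refine le_trans (Nat.add_le_add ?_ ?_) hkn
      · by_cases hx' : x ∈ exps (e p)
        · exact ((hem p hp).2.2 x hx').2.1
        · rw [Multiset.count_eq_zero_of_notMem hx']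
          exact Nat.zero_le _
      · exact (Multiset.count_le_of_le _ (Multiset.erase_le _ _)).trans (hcount x)
    · refine le_trans ?_ hkk
      rcases Multiset.mem_add.1 hx with hx | hx
      · exact ((hem p hp).2.2 x hx).2.2
      · exact (ordNorm_le_of_mem_exps hβε (Multiset.mem_of_mem_erase hx)).trans hk

/-- The derivatives `∂_n` of a `k`-lean ordinal are `4 * k * n`-lean. -/
theorem ordNorm_le_of_mem_derivs {k n : ℕ} {α α' : Ordinal.{0}} (hα : α < ω ^ ω ^ ω)
    (hk : ordNorm α ≤ k) (hn : 0 < n) (h : α' ∈ derivs n α) : ordNorm α' ≤ 4 * k * n := by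
  have hαε := hα.trans omega0_tower_lt_epsilon_zero
  have hα'ε := (lt_of_mem_derivs h).trans hαε
  obtain ⟨β, hβ, rfl⟩ := Finset.mem_image.1 h
  rw [Multiset.mem_toFinset] at hβ
  have hcount : ∀ γ, (exps α).count γ ≤ k := fun γ => (count_le_ordNorm hαε γ).trans hk
  have hk0 : 0 < k := (Multiset.count_pos.2 hβ).trans_le (hcount β)
  have hb := derivPow_bounds (exps_lt_of_lt_opow hα hβ)
    ((ordNorm_le_of_mem_exps hαε hβ).trans hk) hk0 hn
  have h1 : (n + 1) * k + k ≤ 4 * k * n := by nlinarith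
  have h2 : k ≤ 4 * k * n := by nlinarith
  have h3 : 3 * k * n ≤ 4 * k * n := by nlinarith
  rw [ordNorm_le_iff hα'ε, exps_natSum, exps_ofExps]
  intro γ hγ
  constructor
  · rw [Multiset.count_add]
    refine le_trans (Nat.add_le_add ?_ ?_) h1
    · by_cases hγ' : γ ∈ exps (derivPow n β)
      · exact (hb γ hγ').1
      · rw [Multiset.count_eq_zero_of_notMem hγ']
        exact Nat.zero_le _
    · exact (Multiset.count_le_of_le _ (Multiset.erase_le _ _)).trans (hcount γ)
  · rcases Multiset.mem_add.1 hγ with hγ | hγ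
    · exact (hb γ hγ).2.trans h3
    · exact ((ordNorm_le_of_mem_exps hαε (Multiset.mem_of_mem_erase hγ)).trans hk).trans h2

/-- `M_{α,g}(n)` is bounded by the Cichoń hierarchy of `x ↦ 4 x g(x)`. The bound is proved at every
argument from `4 * N α * n` on, so that the induction needs no monotonicity of the hierarchy in its
argument. -/
theorem boundFn_le_cichon {g : ℕ → ℕ} (hg : StrictMono g) {α : Ordinal.{0}} :
    α < ω ^ ω ^ ω → ∀ {n x : ℕ}, 0 < n → 4 * ordNorm α * n ≤ x →
      boundFn g α n ≤ cichon (fun x => 4 * x * g x) α x := by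
  induction α using WellFoundedLT.induction with
  | ind α ih =>
    intro hα n x hn hx
    have hαε := hα.trans omega0_tower_lt_epsilon_zero
    rw [boundFn_eq]
    refine Finset.sup_le fun α' h => ?_
    have hlt := lt_of_mem_derivs h
    have h0 : α ≠ 0 := (hlt.trans_le' zero_le).ne'
    have hgpos : ∀ y, 0 < y → 0 < g y := fun y hy => hy.trans_le hg.le_apply
    have hN := (ordNorm_le_of_mem_derivs hα le_rfl hn h).trans hx
    have hNpos : 0 < ordNorm α := Nat.pos_of_ne_zero fun h => h0 (eq_zero_of_ordNorm_eq_zero hαε h)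
    have hnx : n ≤ x := le_trans (by nlinarith) hx
    have hx0 : 0 < x := hn.trans_le hnx
    have hh : ∀ y, 0 < y → y < 4 * y * g y := fun y hy => by
      have := hgpos y hy
      nlinarith
    rw [cichon, dif_neg h0]
    refine Nat.add_le_add_left ?_ 1
    calc boundFn g α' (g n)
        ≤ cichon (fun x => 4 * x * g x) α' (4 * x * g x) := by
          refine ih α' hlt (hlt.trans hα) (hgpos n hn) ?_
          exact Nat.mul_le_mul (Nat.mul_le_mul_left _ hN) (hg.monotone hnx)
      _ ≤ cichon (fun x => 4 * x * g x) (predAt x α) (4 * x * g x) :=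
          cichon_le_cichon hh ((predAt_lt h0 x).trans hαε)
            (le_predAt_of_ordNorm_le hαε hlt hN) (hx0.trans (hh x hx0)) (hN.trans (hh x hx0).le)

/-! ### Order reflections between normed wqos -/

namespace NormedWqo

/-- `A.Reflects S B`: there is a map from the subset `S` of `A` to `B` that reflects the ordering
and does not increase norms. Such a map sends controlled bad sequences in `S` to controlled bad
sequences over `B`. -/
def Reflects (A : NormedWqo) (S : Set A.carrier) (B : NormedWqo) : Prop :=
  ∃ f : S → B.carrier, (∀ y z, B.le (f y) (f z) → A.le y z) ∧ ∀ y, B.norm (f y) ≤ A.norm y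

end NormedWqo

/-! ### Residuals of `P_f(ℕ^d)` -/

namespace MajNwqo

theorem orderType_lt : ∀ A : MajNwqo, A.orderType < ω ^ ω ^ ω
  | gamma0 => opow_pos _ omega0_pos
  | gamma1 => by
    rw [orderType, ← opow_zero ω, opow_lt_opow_iff_right one_lt_omega0]
    exact opow_pos _ omega0_pos
  | pow d _ => by
    rw [orderType, opow_lt_opow_iff_right one_lt_omega0, opow_lt_opow_iff_right one_lt_omega0]
    exact natCast_lt_omega0 _
  | sum A B => natSum_lt_opow A.orderType_lt B.orderType_lt
  | prod A B => natProd_lt_opow_opow A.orderType_lt B.orderType_lt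

/-- A sum of `m` copies of `Γ₁` has order type `m` and contains `m` pairwise incomparable elements
of norm `0`. -/
theorem exists_antichain (m : ℕ) : ∃ B : MajNwqo, B.orderType = m ∧
    ∃ f : Fin m → B.toNwqo.carrier, (∀ i j, B.toNwqo.le (f i) (f j) → i = j) ∧
      ∀ i, B.toNwqo.norm (f i) = 0 := by
  induction m with
  | zero => exact ⟨gamma0, by rw [orderType, Nat.cast_zero], Fin.elim0, fun i => i.elim0,
      fun i => i.elim0⟩
  | succ m ih =>
    obtain ⟨B, hB, f, hf, hN⟩ := ih
    refine ⟨sum gamma1 B, ?_, Fin.cases (Sum.inl (0 : Fin 1)) fun i => Sum.inr (f i), ?_, ?_⟩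
    · apply exps_injective
      rw [orderType, exps_natSum, hB, orderType, exps_one, exps_natCast, exps_natCast,
        Multiset.replicate_succ, Multiset.singleton_add]
    · intro i j h
      induction i using Fin.cases <;> induction j using Fin.cases
      · rfl
      · cases h
      · cases h
      · cases h with
        | inr h => exact congrArg Fin.succ (hf _ _ h)
    · intro i
      induction i using Fin.cases
      · rfl
      · exact hN _

/-- A product of `m` copies of `P_f(ℕ^(q+1))` has order type `ω^(ω^q * m)` and receives an order
reflection from the families of `m` elements of `P_f(ℕ^(q+1))`. -/
theorem exists_power (q m : ℕ) : ∃ B : MajNwqo,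
    B.orderType = ω ^ (ω ^ (q : Ordinal.{0}) * (m : Ordinal.{0})) ∧
    ∃ f : (Fin m → Finset (Fin (q + 1) → ℕ)) → B.toNwqo.carrier,
      (∀ a b, B.toNwqo.le (f a) (f b) →
        ∀ i, (NormedWqo.natPow (q + 1)).majPowerset.le (a i) (b i)) ∧
      ∀ a N, (∀ i, (NormedWqo.natPow (q + 1)).majPowerset.norm (a i) ≤ N) →
        B.toNwqo.norm (f a) ≤ N := by
  induction m with
  | zero => exact ⟨gamma1, by rw [orderType, Nat.cast_zero, mul_zero, opow_zero],
      fun _ => (0 : Fin 1), fun _ _ _ i => i.elim0, fun _ N _ => Nat.zero_le N⟩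
  | succ m ih =>
    obtain ⟨B, hB, f, hf, hN⟩ := ih
    refine ⟨prod (pow (q + 1) q.succ_pos) B, ?_, fun a => (a 0, f fun i => a i.succ), ?_, ?_⟩
    · rw [orderType, hB, orderType, natProd_opow_opow, Nat.add_sub_cancel]
      congr 1
      apply exps_injective
      rw [exps_natSum, exps_opow, exps_opow_mul_natCast, exps_opow_mul_natCast,
        Multiset.replicate_succ, Multiset.singleton_add]
    · intro a b h i
      induction i using Fin.cases
      · exact h.1
      · exact hf _ _ h.2 _
    · intro a N h
      exact max_le (h 0) (hN _ _ fun i => h i.succ)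

/-- If `X` has norm at most `n`, the elements of a set not above `X` have a coordinate less than
`n`. The bound does not depend on which `x ∈ X` is not majored. -/
theorem exists_apply_lt_of_not_le {d n : ℕ} {X Y : Finset (Fin d → ℕ)}
    (hX : (NormedWqo.natPow d).majPowerset.norm X ≤ n)
    (hXY : ¬ (NormedWqo.natPow d).majPowerset.le X Y) : ∀ y ∈ Y, ∃ i, y i < n := by
  intro y hy
  by_contra! hn
  refine hXY fun x hx => ⟨y, hy, fun i => le_trans ?_ (hn i)⟩
  exact (Finset.le_sup (f := x) (Finset.mem_univ i)).trans
    ((Finset.le_sup (f := (NormedWqo.natPow d).norm) hx).trans ((le_max_left _ _).trans hX))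

theorem majPowerset_natPow_one_le {Y Z : Finset (Fin 1 → ℕ)}
    (h : (Y.sup fun y => y 0 + 1) ≤ Z.sup fun z => z 0 + 1) :
    (NormedWqo.natPow 1).majPowerset.le Y Z := by
  intro y hy
  have hy' := (Finset.le_sup (f := fun y : Fin 1 → ℕ => y 0 + 1) hy).trans h
  have hlt : y 0 < Z.sup fun z => z 0 + 1 := hy'
  obtain ⟨z, hz, hyz⟩ := Finset.lt_sup_iff.1 hlt
  refine ⟨z, hz, fun i => ?_⟩
  obtain rfl := Subsingleton.elim i 0
  exact Nat.lt_succ_iff.1 hyz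

/-- The finite subsets of `ℕ` with all their elements below `n` fall into `n + 1` classes. -/
theorem exists_residual_pow_one {n : ℕ} (X : Finset (Fin 1 → ℕ))
    (hX : (NormedWqo.natPow 1).majPowerset.norm X ≤ n) :
    ∃ B : MajNwqo, B.orderType = derivPow n (ω ^ (0 : Ordinal.{0})) ∧
      (NormedWqo.natPow 1).majPowerset.Reflects
        {Y | ¬ (NormedWqo.natPow 1).majPowerset.le X Y} B.toNwqo := by
  obtain ⟨B, hB, f, hf, hN⟩ := exists_antichain (n + 1)
  refine ⟨B, by rw [hB, derivPow_opow, derivAtom_zero], ?_⟩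
  have hlt : ∀ Y : Finset (Fin 1 → ℕ), ¬ (NormedWqo.natPow 1).majPowerset.le X Y →
      (Y.sup fun y => y 0 + 1) < n + 1 := by
    intro Y hY
    refine (Finset.sup_lt_iff n.succ_pos).2 fun y hy => ?_
    obtain ⟨i, hi⟩ := exists_apply_lt_of_not_le hX hY y hy
    obtain rfl := Subsingleton.elim i 0
    exact Nat.succ_lt_succ hi
  refine ⟨fun Y => f ⟨_, hlt Y.1 Y.2⟩, fun Y Z h => ?_, fun Y => ?_⟩
  · exact majPowerset_natPow_one_le (congrArg Fin.val (hf _ _ h)).le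
  · rw [hN]
    exact Nat.zero_le _

/-- The slice of `Y` where the coordinate `i` has the value `c`, with that coordinate removed. -/
def slice {d : ℕ} (i : Fin (d + 1)) (c : ℕ) (Y : Finset (Fin (d + 1) → ℕ)) :
    Finset (Fin d → ℕ) :=
  (Y.filter fun y => y i = c).image i.removeNth

theorem mem_slice {d : ℕ} {i : Fin (d + 1)} {c : ℕ} {Y : Finset (Fin (d + 1) → ℕ)}
    {w : Fin d → ℕ} : w ∈ slice i c Y ↔ ∃ y ∈ Y, y i = c ∧ i.removeNth y = w := by
  simp only [slice, Finset.mem_image, Finset.mem_filter, and_assoc]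

theorem norm_slice_le {d : ℕ} (i : Fin (d + 1)) (c : ℕ) (Y : Finset (Fin (d + 1) → ℕ)) :
    (NormedWqo.natPow d).majPowerset.norm (slice i c Y)
      ≤ (NormedWqo.natPow (d + 1)).majPowerset.norm Y := by
  refine max_le (Finset.sup_le fun w hw => ?_) ?_
  · obtain ⟨y, hy, -, rfl⟩ := mem_slice.1 hw
    refine (le_max_left _ _).trans' (le_trans ?_
      (Finset.le_sup (f := (NormedWqo.natPow (d + 1)).norm) hy))
    have hsup : Finset.univ.sup (i.removeNth y) ≤ Finset.univ.sup y :=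
      Finset.sup_le fun j _ => Finset.le_sup (f := y) (Finset.mem_univ (i.succAbove j))
    exact hsup
  · have hcard : (slice i c Y).card ≤ Y.card :=
      Finset.card_image_le.trans (Finset.card_filter_le _ _)
    exact hcard.trans (le_max_right _ _)

/-- If `Y` lies in the union of the hyperplanes `y i = c` with `c < n`, it is recovered from its
slices along these hyperplanes. -/
theorem majPowerset_le_of_slice_le {d n : ℕ} {Y Z : Finset (Fin (d + 1) → ℕ)}
    (hY : ∀ y ∈ Y, ∃ i, y i < n)
    (h : ∀ i, ∀ c < n, (NormedWqo.natPow d).majPowerset.le (slice i c Y) (slice i c Z)) :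
    (NormedWqo.natPow (d + 1)).majPowerset.le Y Z := by
  intro y hy
  obtain ⟨i, hi⟩ := hY y hy
  obtain ⟨w, hw, hyw⟩ := h i (y i) hi (i.removeNth y) (mem_slice.2 ⟨y, hy, rfl, rfl⟩)
  obtain ⟨z, hz, hzi, rfl⟩ := mem_slice.1 hw
  refine ⟨z, hz, fun j => ?_⟩
  rcases Fin.eq_self_or_eq_succAbove i j with rfl | ⟨j, rfl⟩
  · exact hzi.ge
  · exact hyw j

/-- The sets not above `X ⊆ ℕ^(q+2)` reflect into a product of `(q + 2) * n` copies of
`P_f(ℕ^(q+1))`, one for each slice. The same slices serve for all `x ∈ X`, so that no sum over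
the elements of `X` is needed. -/
theorem exists_residual_pow_add_two {n q : ℕ} (X : Finset (Fin (q + 2) → ℕ))
    (hX : (NormedWqo.natPow (q + 2)).majPowerset.norm X ≤ n) :
    ∃ B : MajNwqo, B.orderType = derivPow n (ω ^ ((q + 1 : ℕ) : Ordinal.{0})) ∧
      (NormedWqo.natPow (q + 2)).majPowerset.Reflects
        {Y | ¬ (NormedWqo.natPow (q + 2)).majPowerset.le X Y} B.toNwqo := by
  obtain ⟨B, hB, f, hf, hN⟩ := exists_power q ((q + 2) * n)
  refine ⟨B, by rw [hB, derivPow_opow, derivAtom_add_one], ?_⟩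
  refine ⟨fun Y => f fun j => slice (finProdFinEquiv.symm j).1 (finProdFinEquiv.symm j).2 Y.1,
    fun Y Z h => ?_, fun Y => hN _ _ fun j => norm_slice_le _ _ _⟩
  refine majPowerset_le_of_slice_le (exists_apply_lt_of_not_le hX Y.2) fun i c hc => ?_
  have h1 := hf _ _ h (finProdFinEquiv (i, ⟨c, hc⟩))
  simpa only [Equiv.symm_apply_apply] using h1

/-! ### Residuals of sums and products -/

/-- `A.Splits n x β P R P'`: the element `x` lies in a summand `P` of `A` of order type `ω^β`, the
rest of `A` is `R`, and the elements of `P` not above `x` reflect into `P'`, whose order type is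
`D_n(ω^β)`. -/
structure Splits (A : MajNwqo) (n : ℕ) (x : A.toNwqo.carrier) (β : Ordinal.{0})
    (P R P' : MajNwqo) : Prop where
  exps_eq : exps A.orderType = β ::ₘ exps R.orderType
  orderType_summand : P.orderType = ω ^ β
  orderType_residual : P'.orderType = derivPow n β
  exists_reflects : ∃ (e : A.toNwqo.carrier → P.toNwqo.carrier ⊕ R.toNwqo.carrier)
    (p : P.toNwqo.carrier),
    (∀ y z, (P.sum R).toNwqo.le (e y) (e z) → A.toNwqo.le y z) ∧
    (∀ y, (P.sum R).toNwqo.norm (e y) ≤ A.toNwqo.norm y) ∧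
    e x = Sum.inl p ∧ P.toNwqo.Reflects {y | ¬ P.toNwqo.le p y} P'.toNwqo

theorem exists_splits_of_orderType_eq_opow {A P' : MajNwqo} {n : ℕ} {x : A.toNwqo.carrier}
    {β : Ordinal.{0}} (hA : A.orderType = ω ^ β) (hP' : P'.orderType = derivPow n β)
    (h : A.toNwqo.Reflects {y | ¬ A.toNwqo.le x y} P'.toNwqo) : A.Splits n x β A gamma0 P' where
  exps_eq := by rw [hA, exps_opow, orderType, exps_zero, Multiset.cons_zero]
  orderType_summand := hA
  orderType_residual := hP'
  exists_reflects := by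
    refine ⟨Sum.inl, x, fun y z h => ?_, fun y => le_rfl, rfl, h⟩
    cases h with
    | inl h => exact h

theorem Splits.sum_inl {A : MajNwqo} {n : ℕ} {x : A.toNwqo.carrier} {β : Ordinal.{0}}
    {P R P' : MajNwqo} (h : A.Splits n x β P R P') (B : MajNwqo) :
    (A.sum B).Splits n (Sum.inl x) β P (R.sum B) P' where
  exps_eq := by
    rw [orderType, orderType, exps_natSum, exps_natSum, h.exps_eq, Multiset.cons_add]
  orderType_summand := h.orderType_summand
  orderType_residual := h.orderType_residual
  exists_reflects := by
    obtain ⟨e, p, he, hN, hp, hr⟩ := h.exists_reflects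
    refine ⟨Sum.elim (fun y => (e y).map id Sum.inl) (fun z => Sum.inr (Sum.inr z)), p,
      ?_, ?_, ?_, hr⟩
    · rintro (y | y) (z | z) h
      · refine .inl (he _ _ ?_)
        simp only [Sum.elim_inl] at h
        rcases hy : e y with u | u <;> rcases hz : e z with v | v <;> rw [hy, hz] at h <;>
          cases h
        · rename_i h
          exact .inl h
        · rename_i h
          cases h with
          | inl h => exact .inr h
      · simp only [Sum.elim_inl, Sum.elim_inr] at h
        rcases hy : e y with u | u <;> rw [hy] at h <;> cases h
        rename_i h
        cases h
      · simp only [Sum.elim_inl, Sum.elim_inr] at h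
        rcases hz : e z with u | u <;> rw [hz] at h <;> cases h
        rename_i h
        cases h
      · cases h with
        | inr h =>
          cases h with
          | inr h => exact .inr h
    · rintro (y | y)
      · have := hN y
        simp only [Sum.elim_inl]
        rcases hy : e y with u | u <;> rw [hy] at this <;> exact this
      · exact le_rfl
    · simp only [Sum.elim_inl, hp]
      rfl

theorem Splits.sum_inr {A : MajNwqo} {n : ℕ} {x : A.toNwqo.carrier} {β : Ordinal.{0}}
    {P R P' : MajNwqo} (h : A.Splits n x β P R P') (B : MajNwqo) :
    (B.sum A).Splits n (Sum.inr x) β P (R.sum B) P' where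
  exps_eq := by
    rw [orderType, natSum_comm, ← orderType]
    exact (h.sum_inl B).exps_eq
  orderType_summand := h.orderType_summand
  orderType_residual := h.orderType_residual
  exists_reflects := by
    obtain ⟨e, p, he, hN, hp, hr⟩ := (h.sum_inl B).exists_reflects
    refine ⟨fun y => e (Sum.swap y), p, fun y z h => ?_, fun y => (hN _).trans ?_, hp, hr⟩
    · have := he _ _ h
      rcases y with y | y <;> rcases z with z | z <;> cases this
      · rename_i h
        exact .inl h
      · rename_i h
        exact .inr h
    · rcases y with y | y <;> exact le_rfl

/-- In a product of `P + R` and `Q + S`, the summand `P × Q` contains the given element, and by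
the Leibniz rule its residual reflects into `P' × Q + P × Q'`. -/
theorem Splits.prod {A B : MajNwqo} {n : ℕ} {x : A.toNwqo.carrier} {y : B.toNwqo.carrier}
    {β γ : Ordinal.{0}} {P R P' Q S Q' : MajNwqo} (hA : A.Splits n x β P R P')
    (hB : B.Splits n y γ Q S Q') :
    (A.prod B).Splits n (x, y) (natSum β γ) (P.prod Q)
      ((P.prod S).sum ((R.prod Q).sum (R.prod S))) ((P'.prod Q).sum (P.prod Q')) where
  exps_eq := by
    simp only [orderType, exps_natSum, exps_natProd, hA.exps_eq, hB.exps_eq,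
      hA.orderType_summand, hB.orderType_summand, exps_opow]
    simp only [← Multiset.cons_zero, Multiset.cons_product, Multiset.product_cons,
      Multiset.map_add, Multiset.map_cons, Multiset.map_map, Multiset.zero_product,
      Multiset.product_zero, add_zero, Multiset.cons_add]
    rw [add_left_comm]
  orderType_summand := by
    rw [orderType, hA.orderType_summand, hB.orderType_summand, natProd_opow_opow]
  orderType_residual := by
    simp only [orderType, hA.orderType_summand, hB.orderType_summand, hA.orderType_residual,
      hB.orderType_residual, derivPow_natSum]
  exists_reflects := by
    obtain ⟨e, p, he, heN, hp, r, hr, hrN⟩ := hA.exists_reflects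
    obtain ⟨f, q, hf, hfN, hq, s, hs, hsN⟩ := hB.exists_reflects
    let F : (P.toNwqo.carrier ⊕ R.toNwqo.carrier) → (Q.toNwqo.carrier ⊕ S.toNwqo.carrier) →
        ((P.prod Q).toNwqo.carrier ⊕
          ((P.prod S).sum ((R.prod Q).sum (R.prod S))).toNwqo.carrier)
      | .inl a, .inl b => .inl (a, b)
      | .inl a, .inr b => .inr (.inl (a, b))
      | .inr a, .inl b => .inr (.inr (.inl (a, b)))
      | .inr a, .inr b => .inr (.inr (.inr (a, b)))
    have hF : ∀ a b a' b', ((P.prod Q).sum ((P.prod S).sum ((R.prod Q).sum (R.prod S)))).toNwqo.le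
        (F a b) (F a' b') → (P.sum R).toNwqo.le a a' ∧ (Q.sum S).toNwqo.le b b' := by
      rintro (a | a) (b | b) (a' | a') (b' | b') h
      · cases h with
        | inl h => exact ⟨.inl h.1, .inl h.2⟩
      all_goals cases h
      all_goals rename_i h
      all_goals cases h
      all_goals rename_i h
      · exact ⟨.inl h.1, .inr h.2⟩
      all_goals cases h
      all_goals rename_i h
      · exact ⟨.inr h.1, .inl h.2⟩
      · exact ⟨.inr h.1, .inr h.2⟩
    have hFN : ∀ a b, ((P.prod Q).sum ((P.prod S).sum ((R.prod Q).sum (R.prod S)))).toNwqo.norm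
        (F a b) = max ((P.sum R).toNwqo.norm a) ((Q.sum S).toNwqo.norm b) := by
      rintro (a | a) (b | b) <;> rfl
    refine ⟨fun z => F (e z.1) (f z.2), (p, q), fun z w h => ?_, fun z => ?_, ?_, ?_⟩
    · exact ⟨he _ _ (hF _ _ _ _ h).1, hf _ _ (hF _ _ _ _ h).2⟩
    · exact (hFN _ _).trans_le (max_le_max (heN _) (hfN _))
    · simp only [hp, hq]
      rfl
    · have key : ∀ z : {z | ¬ (P.prod Q).toNwqo.le (p, q) z},
          ∃ w : ((P'.prod Q).sum (P.prod Q')).toNwqo.carrier,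
            (∃ h, w = Sum.inl (r ⟨z.1.1, h⟩, z.1.2)) ∨
              ∃ h, w = Sum.inr (z.1.1, s ⟨z.1.2, h⟩) := by
        intro z
        by_cases h : P.toNwqo.le p z.1.1
        · exact ⟨_, .inr ⟨fun h' => z.2 ⟨h, h'⟩, rfl⟩⟩
        · exact ⟨_, .inl ⟨h, rfl⟩⟩
      choose G hG using key
      refine ⟨G, fun z w h => ?_, fun z => ?_⟩
      · rcases hG z with ⟨_, hz⟩ | ⟨_, hz⟩ <;> rcases hG w with ⟨_, hw⟩ | ⟨_, hw⟩ <;>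
          rw [hz, hw] at h <;> cases h
        · rename_i h
          exact ⟨hr _ _ h.1, h.2⟩
        · rename_i h
          exact ⟨h.1, hs _ _ h.2⟩
      · rcases hG z with ⟨_, hz⟩ | ⟨_, hz⟩ <;> rw [hz]
        · exact max_le_max (hrN _) le_rfl
        · exact max_le_max le_rfl (hsN _)

/-- Every element of norm at most `n` lies in a summand of order type a power of `ω` whose
residual has the derivative as order type. -/
theorem exists_splits {n : ℕ} : ∀ (A : MajNwqo) (x : A.toNwqo.carrier), A.toNwqo.norm x ≤ n →
    ∃ β P R P', A.Splits n x β P R P'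
  | gamma0, x, _ => Fin.elim0 x
  | gamma1, x, _ => by
    refine ⟨0, _, _, gamma0, exists_splits_of_orderType_eq_opow ?_ ?_ ?_⟩
    · rw [orderType, opow_zero]
    · rw [orderType, derivPow_zero]
    · have h : ∀ y : Fin 1, y ∉ {y | ¬ gamma1.toNwqo.le x y} := fun y hy =>
        hy (Subsingleton.elim (α := Fin 1) _ _)
      exact ⟨fun y => absurd y.2 (h y.1), fun y => absurd y.2 (h y.1),
        fun y => absurd y.2 (h y.1)⟩
  | pow 0 hd, _, _ => absurd hd (lt_irrefl 0)
  | pow 1 _, X, hX => by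
    obtain ⟨B, hB, hr⟩ := exists_residual_pow_one X hX
    refine ⟨_, _, _, B, exists_splits_of_orderType_eq_opow ?_ hB hr⟩
    rw [orderType, Nat.sub_self, Nat.cast_zero]
  | pow (q + 2) _, X, hX => by
    obtain ⟨B, hB, hr⟩ := exists_residual_pow_add_two X hX
    exact ⟨_, _, _, B, exists_splits_of_orderType_eq_opow rfl hB hr⟩
  | sum A B, Sum.inl x, hx => by
    obtain ⟨β, P, R, P', h⟩ := exists_splits A x hx
    exact ⟨_, _, _, _, h.sum_inl B⟩
  | sum A B, Sum.inr x, hx => by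
    obtain ⟨β, P, R, P', h⟩ := exists_splits B x hx
    exact ⟨_, _, _, _, h.sum_inr A⟩
  | prod A B, (x, y), hxy => by
    obtain ⟨β, P, R, P', h⟩ := exists_splits A x ((le_max_left _ _).trans hxy)
    obtain ⟨γ, Q, S, Q', h'⟩ := exists_splits B y ((le_max_right _ _).trans hxy)
    exact ⟨_, _, _, _, h.prod h'⟩

/-- The residual of `A` at an element of norm at most `n` reflects into a majoring powerset nwqo
whose order type belongs to `∂_n(o(A))`. -/
theorem exists_residual {n : ℕ} (A : MajNwqo) (x : A.toNwqo.carrier) (hx : A.toNwqo.norm x ≤ n) :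
    ∃ B : MajNwqo, B.orderType ∈ derivs n A.orderType ∧
      A.toNwqo.Reflects {y | ¬ A.toNwqo.le x y} B.toNwqo := by
  obtain ⟨β, P, R, P', h⟩ := exists_splits A x hx
  have hβ : β ∈ exps A.orderType := h.exps_eq ▸ Multiset.mem_cons_self _ _
  refine ⟨P'.sum R, Finset.mem_image.2 ⟨β, Multiset.mem_toFinset.2 hβ, ?_⟩, ?_⟩
  · rw [orderType, h.orderType_residual, h.exps_eq, Multiset.erase_cons_head, ofExps_exps]
  · obtain ⟨e, p, he, heN, hp, r, hr, hrN⟩ := h.exists_reflects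
    have hne : ∀ y ∈ {y | ¬ A.toNwqo.le x y}, ∀ u, e y = Sum.inl u → ¬ P.toNwqo.le p u := by
      intro y hy u hu hle
      refine hy (he _ _ ?_)
      rw [hp, hu]
      exact .inl hle
    have key : ∀ y : {y | ¬ A.toNwqo.le x y},
        ∃ z : (P'.sum R).toNwqo.carrier,
          (∃ u, ∃ hu : ¬ P.toNwqo.le p u, e y.1 = Sum.inl u ∧ z = Sum.inl (r ⟨u, hu⟩)) ∨
          ∃ u, e y.1 = Sum.inr u ∧ z = Sum.inr u := by
      intro y
      rcases hu : e y.1 with u | u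
      · exact ⟨_, .inl ⟨u, hne y.1 y.2 u hu, rfl, rfl⟩⟩
      · exact ⟨_, .inr ⟨u, rfl, rfl⟩⟩
    choose f hf using key
    refine ⟨f, fun y z hle => he _ _ ?_, fun y => (heN y.1).trans' ?_⟩
    · rcases hf y with ⟨u, hu, h1, h2⟩ | ⟨u, h1, h2⟩ <;>
        rcases hf z with ⟨v, hv, h3, h4⟩ | ⟨v, h3, h4⟩ <;> rw [h2, h4] at hle <;> rw [h1, h3] <;>
        cases hle
      · rename_i hle
        exact .inl (hr _ _ hle)
      · rename_i hle
        exact .inr hle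
    · rcases hf y with ⟨u, hu, h1, h2⟩ | ⟨u, h1, h2⟩ <;> rw [h1, h2]
      · exact hrN ⟨u, hu⟩
      · exact le_rfl

/-! ### The length function -/

/-- The tail of a bad sequence avoids the elements above its first entry, hence is reflected into
a residual. -/
theorem length_le_boundFn (g : ℕ → ℕ) {α : Ordinal.{0}} : ∀ (A : MajNwqo), A.orderType = α →
    ∀ (n l : ℕ), l ∈ A.toNwqo.controlledBadLengths g n → l ≤ boundFn g α n := by
  induction α using WellFoundedLT.induction with
  | ind α ih =>
    rintro A rfl n (_ | l) ⟨x, hc, hb⟩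
    · exact Nat.zero_le _
    · obtain ⟨B, hB, f, hf, hfN⟩ := exists_residual A (x 0) (hc 0)
      have hmem : ∀ i : Fin l, x i.succ ∈ {y | ¬ A.toNwqo.le (x 0) y} := fun i =>
        hb 0 i.succ i.succ_pos
      have htail : l ∈ B.toNwqo.controlledBadLengths g (g n) :=
        ⟨fun i => f ⟨x i.succ, hmem i⟩, fun i => (hfN _).trans (hc i.succ),
          fun i j hij h => hb i.succ j.succ (Fin.succ_lt_succ_iff.2 hij) (hf _ _ h)⟩
      have h1 := ih _ (lt_of_mem_derivs hB) B rfl (g n) l htail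
      rw [boundFn_eq]
      calc l + 1 ≤ 1 + boundFn g B.orderType (g n) := by omega
        _ ≤ _ := Finset.le_sup (f := fun α' => 1 + boundFn g α' (g n)) hB

theorem isGreatest_lengthFn (g : ℕ → ℕ) (A : MajNwqo) (n : ℕ) :
    IsGreatest (A.toNwqo.controlledBadLengths g n) (A.toNwqo.lengthFn g n) := by
  have hbdd : BddAbove (A.toNwqo.controlledBadLengths g n) :=
    ⟨_, fun l hl => length_le_boundFn g A rfl n l hl⟩
  exact ⟨Nat.sSup_mem ⟨0, Fin.elim0, fun i => i.elim0, fun i => i.elim0⟩ hbdd,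
    fun l hl => le_csSup hbdd hl⟩

theorem isLean_orderType_pow (d : ℕ) (hd : 0 < d) : IsLean d (pow d hd).orderType := by
  have h1 := (pow d hd).orderType_lt.trans omega0_tower_lt_epsilon_zero
  have h2 : ω ^ ((d - 1 : ℕ) : Ordinal.{0}) < ε₀ := by
    refine lt_of_le_of_lt ?_ h1
    exact right_le_opow _ one_lt_omega0
  rw [IsLean, ordNorm_le_iff h1, orderType, exps_opow]
  intro β hβ
  obtain rfl := Multiset.mem_singleton.1 hβ
  rw [Multiset.count_singleton_self, ordNorm_le_iff h2, exps_opow]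
  refine ⟨hd, fun p hp => ?_⟩
  obtain rfl := Multiset.mem_singleton.1 hp
  rw [Multiset.count_singleton_self, ordNorm_natCast]
  omega

end MajNwqo

end MajoringPowerset

theorem mainTheorem5 (g : ℕ → ℕ) (hg : StrictMono g) :
    (∀ (A : MajoringPowerset.MajNwqo) (k n : ℕ),
      MajoringPowerset.IsLean k A.orderType → 0 < n →
        IsGreatest (A.toNwqo.controlledBadLengths g n) (A.toNwqo.lengthFn g n) ∧
        A.toNwqo.lengthFn g n ≤ MajoringPowerset.boundFn g A.orderType n ∧
        MajoringPowerset.boundFn g A.orderType n ≤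
          MajoringPowerset.cichon (fun x => 4 * x * g x) A.orderType (4 * k * n)) ∧
    (∀ d n : ℕ, 0 < d → 0 < n →
      IsGreatest ((MajoringPowerset.NormedWqo.natPow d).majPowerset.controlledBadLengths g n)
        ((MajoringPowerset.NormedWqo.natPow d).majPowerset.lengthFn g n) ∧
      (MajoringPowerset.NormedWqo.natPow d).majPowerset.lengthFn g n ≤
        MajoringPowerset.cichon (fun x => 4 * x * g x)
          (ω ^ (ω ^ ((d - 1 : ℕ) : Ordinal.{0}))) (4 * d * n)) := by
  have main : ∀ (A : MajoringPowerset.MajNwqo) (k n : ℕ),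
      MajoringPowerset.IsLean k A.orderType → 0 < n →
        IsGreatest (A.toNwqo.controlledBadLengths g n) (A.toNwqo.lengthFn g n) ∧
        A.toNwqo.lengthFn g n ≤ MajoringPowerset.boundFn g A.orderType n ∧
        MajoringPowerset.boundFn g A.orderType n ≤
          MajoringPowerset.cichon (fun x => 4 * x * g x) A.orderType (4 * k * n) := by
    intro A k n hk hn
    have hmax := A.isGreatest_lengthFn g n
    exact ⟨hmax, A.length_le_boundFn g rfl n _ hmax.1,
      MajoringPowerset.boundFn_le_cichon hg A.orderType_lt hn
        (Nat.mul_le_mul_right _ (Nat.mul_le_mul_left _ hk))⟩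
  refine ⟨main, fun d n hd hn => ?_⟩
  obtain ⟨h1, h2, h3⟩ := main (.pow d hd) d n (MajoringPowerset.MajNwqo.isLean_orderType_pow d hd) hn
  exact ⟨h1, h2.trans h3⟩
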